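/- Let $I$ be a nonempty linearly ordered set (the domain, for instance $\mathbb Z$ or $\mathbb Q$) whose elements are coded by natural numbers, so that they can be part of the input of an algorithm. Let $k\ge 0$ and let $\alpha$ be an aggregation function over $I^k$, that is, an arbitrary function from finite bags of $k$-tuples over $I$ to some set. *Queries.* A term is a variable or a constant from $I$. A condition is a conjunction of positive relational atoms $p(t_1,\dots,t_n)$, negated relational atoms, and comparisons $s\mathrel{\rho}t$ with $\rho\in\{<,\le,=,\ne,\ge,>\}$. It is safe if each of its variables is limited, i.e. occurs in a positive relational atom of the condition or is equated in it with a constant or with a limited variable. A disjunctive $\alpha$-query has the form $q(\bar x,\alpha(\bar y))\leftarrow A_1\vee\dots\vee A_n$, where $\bar x$ is a tuple of grouping variables, $\bar y$ is a $k$-tuple of aggregation variables, and each $A_i$ is a safe condition that contains all variables of $\bar x$ and $\bar y$. A database $D$ is a finite set of ground relational atoms over $I$; its carrier is the set of constants occurring in it. Over $D$, the query $q$ returns the pair $(\bar d,\alpha(B_{\bar d}))$ for each $\bar d$ such that $\bar d=\gamma(\bar x)$ for some assignment $\gamma$ satisfying some $A_i$ over $D$; here $B_{\bar d}$ is the bag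 that contains one copy of $\gamma(\bar y)$ for each pair $(i,\gamma)$ such that $\gamma$ is an assignment of the variables of $A_i$ that satisfies $A_i$ over $D$ and $\gamma(\bar x)=\bar d$. Queries $q,q'$ are $N$-equivalent if they return the same results over all databases whose carrier has at most $N$ elements. The bounded equivalence problem for disjunctive $\alpha$-queries with comparisons ranging over $I$ is to decide, given $N>0$ and two such queries $q,q'$, whether $q$ and $q'$ are $N$-equivalent. *Ordered identities.* A complete ordering of a finite set $T$ of terms with respect to $I$ is a conjunction $L$ of comparisons between terms of $T$ such that, for all $t,t'\in T$, exactly one of $t<t'$, $t>t'$, $t=t'$ is entailed by $L$ over $I$. An ordered identity for $\alpha$ is a formula $L\to\alpha(B)=\alpha(B')$ where $L$ is a complete ordering of some finite set $T$ of terms with respect to $I$, and $B,B'$ are finite bags of $k$-tuples of terms from $T$. It is valid over $I$ if $\alpha(\delta(B))=\alpha(\delta(B'))$ for every assignment $\delta$ of elements of $I$ to the variables that satisfies $L$. The function $\alpha$ is order-decidable over $I$ if the set of valid ordered identities for $\alpha$ is decidable. **Theorem (Bounded Equivalence and Order-Decidability).** The bounded equivalence problem is decidable for disjunctive $\alpha$-queries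 with comparisons ranging over $I$ if and only if $\alpha$ is order-decidable over $I$. -/

import Mathlib

namespace AggQuery

/-- A term over the domain `I`: a variable (variables are numbered) or a constant of `I`. -/
inductive Term (I : Type*) where
  | var (v : ℕ)
  | const (c : I)

/-- The ordering predicates `<`, `≤`, `=`, `≠`, `≥`, `>`. -/
inductive CmpOp where
  | lt | le | eq | ne | ge | gt

/-- An ordering atom (comparison) `lhs op rhs`. -/
structure Comparison (I : Type*) where
  lhs : Term I
  op : CmpOp
  rhs : Term I

/-- A relational atom `p(t₁, …, tₙ)`. A predicate symbol is given by its name `pred` together with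
its arity, the length of the argument list. -/
structure Atom (I : Type*) where
  pred : ℕ
  args : List (Term I)

/-- A condition: a conjunction of positive relational atoms, negated relational atoms and
comparisons. -/
structure Condition (I : Type*) where
  pos : List (Atom I)
  neg : List (Atom I)
  cmp : List (Comparison I)

/-- A disjunctive aggregate query `q(x̄, α(ȳ)) ← A₁ ∨ … ∨ Aₙ`: the grouping variables `x̄`, the
`k` aggregation variables `ȳ`, and the disjuncts. The aggregation function itself enters only when
the query is evaluated. -/
structure Query (I : Type*) (k : ℕ) where
  group : List ℕ
  agg : Fin k → ℕ
  body : List (Condition I)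

/-- The data of a formula `L → α(B) = α(B')`: a finite set `T` of terms, a conjunction `L` of
comparisons and two bags of `k`-tuples of terms; set, conjunction and bags are given as lists. -/
structure Identity (I : Type*) (k : ℕ) where
  T : List (Term I)
  L : List (Comparison I)
  B : List (Fin k → Term I)
  B' : List (Fin k → Term I)

section Coding

/-! The evident codings of the syntactic objects, as products, sums and lists. -/

variable {I : Type*}

def Term.equiv : Term I ≃ ℕ ⊕ I where
  toFun t := match t with
    | .var v => .inl v
    | .const c => .inr c
  invFun s := match s with
    | .inl v => .var v
    | .inr c => .const c
  left_inv t := by cases t <;> rfl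
  right_inv s := by cases s <;> rfl

def CmpOp.equiv : CmpOp ≃ Fin 6 where
  toFun o := match o with
    | .lt => 0
    | .le => 1
    | .eq => 2
    | .ne => 3
    | .ge => 4
    | .gt => 5
  invFun := ![.lt, .le, .eq, .ne, .ge, .gt]
  left_inv o := by cases o <;> rfl
  right_inv i := by fin_cases i <;> rfl

def Comparison.equiv : Comparison I ≃ Term I × CmpOp × Term I where
  toFun c := (c.lhs, c.op, c.rhs)
  invFun p := ⟨p.1, p.2.1, p.2.2⟩
  left_inv _ := rfl
  right_inv _ := rfl

def Atom.equiv : Atom I ≃ ℕ × List (Term I) where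
  toFun a := (a.pred, a.args)
  invFun p := ⟨p.1, p.2⟩
  left_inv _ := rfl
  right_inv _ := rfl

def Condition.equiv : Condition I ≃ List (Atom I) × List (Atom I) × List (Comparison I) where
  toFun A := (A.pos, A.neg, A.cmp)
  invFun p := ⟨p.1, p.2.1, p.2.2⟩
  left_inv _ := rfl
  right_inv _ := rfl

def Query.equiv {k : ℕ} : Query I k ≃ List ℕ × (Fin k → ℕ) × List (Condition I) where
  toFun q := (q.group, q.agg, q.body)
  invFun p := ⟨p.1, p.2.1, p.2.2⟩
  left_inv _ := rfl
  right_inv _ := rfl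

def Identity.equiv {k : ℕ} : Identity I k ≃
    List (Term I) × List (Comparison I) × List (Fin k → Term I) × List (Fin k → Term I) where
  toFun e := (e.T, e.L, e.B, e.B')
  invFun p := ⟨p.1, p.2.1, p.2.2.1, p.2.2.2⟩
  left_inv _ := rfl
  right_inv _ := rfl

variable [Primcodable I]

instance : Primcodable (Term I) := Primcodable.ofEquiv _ Term.equiv
instance : Primcodable CmpOp := Primcodable.ofEquiv _ CmpOp.equiv
instance : Primcodable (Comparison I) := Primcodable.ofEquiv _ Comparison.equiv
instance : Primcodable (Atom I) := Primcodable.ofEquiv _ Atom.equiv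
instance : Primcodable (Condition I) := Primcodable.ofEquiv _ Condition.equiv
instance {k : ℕ} : Primcodable (Query I k) := Primcodable.ofEquiv _ Query.equiv
instance {k : ℕ} : Primcodable (Identity I k) := Primcodable.ofEquiv _ Identity.equiv

end Coding

section Variables

variable {I : Type*}

def Term.vars : Term I → List ℕ
  | .var v => [v]
  | .const _ => []

/-- The variables occurring in a condition. -/
def Condition.vars (A : Condition I) : List ℕ :=
  (A.pos ++ A.neg).flatMap (fun a => a.args.flatMap Term.vars) ++
    A.cmp.flatMap (fun c => c.lhs.vars ++ c.rhs.vars)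

/-- The condition contains the equality `s = t` or the equality `t = s`. -/
def Condition.Equates (A : Condition I) (s t : Term I) : Prop :=
  (⟨s, .eq, t⟩ : Comparison I) ∈ A.cmp ∨ (⟨t, .eq, s⟩ : Comparison I) ∈ A.cmp

/-- A variable is limited in `A` if it occurs in a positive relational atom of `A`, or is equated
in `A` with a constant or with a limited variable. -/
inductive Condition.Limited (A : Condition I) : ℕ → Prop
  | pos {v : ℕ} {a : Atom I} (ha : a ∈ A.pos) (hv : Term.var v ∈ a.args) : Limited A v
  | const {v : ℕ} {c : I} (h : A.Equates (.var v) (.const c)) : Limited A v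
  | eq {v w : ℕ} (hw : Limited A w) (h : A.Equates (.var v) (.var w)) : Limited A v

/-- A condition is safe if all its variables are limited. -/
def Condition.Safe (A : Condition I) : Prop := ∀ v ∈ A.vars, A.Limited v

/-- Every disjunct is safe and contains all variables of the head. -/
def Query.WellFormed {k : ℕ} (q : Query I k) : Prop :=
  ∀ A ∈ q.body, A.Safe ∧ (∀ v ∈ q.group, v ∈ A.vars) ∧ ∀ i, q.agg i ∈ A.vars

end Variables

section Semantics

variable {I : Type*}

/-- The value of a term under an assignment; constants are mapped to themselves. -/
def Term.eval (δ : ℕ → I) : Term I → I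
  | .var v => δ v
  | .const c => c

def CmpOp.Holds [LinearOrder I] : CmpOp → I → I → Prop
  | .lt, a, b => a < b
  | .le, a, b => a ≤ b
  | .eq, a, b => a = b
  | .ne, a, b => a ≠ b
  | .ge, a, b => a ≥ b
  | .gt, a, b => a > b

/-- The assignment `δ` satisfies a comparison. -/
def Comparison.Holds [LinearOrder I] (c : Comparison I) (δ : ℕ → I) : Prop :=
  c.op.Holds (c.lhs.eval δ) (c.rhs.eval δ)

/-- A database: a finite set of ground relational atoms with constants from `I`. -/
abbrev Database (I : Type*) := Finset (ℕ × List I)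

/-- The carrier of a database: the set of constants occurring in it. -/
def Database.carrier [LinearOrder I] (D : Database I) : Finset I :=
  D.biUnion fun a => a.2.toFinset

/-- The ground atom obtained from `a` under `δ` belongs to `D`. -/
def Atom.Holds (a : Atom I) (D : Database I) (δ : ℕ → I) : Prop :=
  (a.pred, a.args.map (Term.eval δ)) ∈ D

/-- The assignment `δ` satisfies the condition `A` over the database `D`. -/
def Condition.Holds [LinearOrder I] (A : Condition I) (D : Database I) (δ : ℕ → I) : Prop :=
  (∀ a ∈ A.pos, a.Holds D δ) ∧ (∀ a ∈ A.neg, ¬ a.Holds D δ) ∧ ∀ c ∈ A.cmp, c.Holds δ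

/-- The set of satisfying assignments of a condition over a database. An assignment for `A` is a
map from the variables of `A` to `I`; it is represented by the map on all variables that takes a
fixed dummy value on the variables that do not occur in `A`. -/
def Condition.satisfying [LinearOrder I] [Nonempty I] (A : Condition I) (D : Database I) :
    Set (ℕ → I) :=
  {γ | (∀ v, v ∉ A.vars → γ v = Classical.arbitrary I) ∧ A.Holds D γ}

/-- Over a database, a safe condition has only finitely many satisfying assignments. -/
theorem Condition.Safe.finite_satisfying [LinearOrder I] [Nonempty I] {A : Condition I}
    (hA : A.Safe) (D : Database I) : (A.satisfying D).Finite := by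
  classical
  let S : Finset I := D.carrier ∪ (A.cmp.flatMap fun c => [c.lhs, c.rhs].filterMap fun t =>
    match t with
    | .var _ => none
    | .const c => some c).toFinset
  have key : ∀ γ ∈ A.satisfying D, ∀ v, A.Limited v → γ v ∈ S := by
    intro γ hγ v hv
    induction hv with
    | @pos v a ha hv =>
      refine Finset.mem_union_left _ (Finset.mem_biUnion.2 ⟨_, hγ.2.1 a ha, ?_⟩)
      simpa using ⟨_, hv, rfl⟩
    | @const v c h =>
      have hc : γ v = c := by
        rcases h with h | h
        · exact hγ.2.2.2 _ h
        · exact (hγ.2.2.2 _ h).symm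
      refine Finset.mem_union_right _ ?_
      rw [List.mem_toFinset, List.mem_flatMap]
      rcases h with h | h
      · exact ⟨_, h, by simp [hc]⟩
      · exact ⟨_, h, by simp [hc]⟩
    | @eq v w hw h ih =>
      have hc : γ v = γ w := by
        rcases h with h | h
        · exact hγ.2.2.2 _ h
        · exact (hγ.2.2.2 _ h).symm
      rw [hc]; exact ih
  let V : Finset ℕ := A.vars.toFinset
  refine Set.Finite.of_finite_image (f := fun γ (v : V) => γ v) ?_ ?_
  · refine Set.Finite.subset (Set.Finite.pi' fun _ : V => S.finite_toSet) ?_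
    rintro _ ⟨γ, hγ, rfl⟩ v
    exact key γ hγ v (hA v (List.mem_toFinset.1 v.2))
  · intro γ hγ γ' hγ' h
    funext v
    by_cases hv : v ∈ A.vars
    · exact congrFun h ⟨v, by simpa [V] using hv⟩
    · rw [hγ.1 v hv, hγ'.1 v hv]

/-- The bag of `k`-tuples that `q` collects over `D` for the group `d`: every disjunct contributes
the tuple `γ(ȳ)` once for each of its satisfying assignments `γ` with `γ(x̄) = d`. -/
noncomputable def Query.bag [LinearOrder I] [Nonempty I] {k : ℕ} (q : Query I k)
    (D : Database I) (d : List I) : Multiset (Fin k → I) :=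
  (q.body.map fun A =>
    ∑ᶠ γ ∈ {γ | γ ∈ A.satisfying D ∧ q.group.map γ = d},
      ({fun i => γ (q.agg i)} : Multiset (Fin k → I))).sum

/-- The result of evaluating `q(x̄, α(ȳ))` over `D`: one pair of a group and an aggregate value for
each group that arises from a satisfying assignment of some disjunct. -/
def Query.result [LinearOrder I] [Nonempty I] {k : ℕ} {V : Type*}
    (α : Multiset (Fin k → I) → V) (q : Query I k) (D : Database I) : Set (List I × V) :=
  {r | (∃ A ∈ q.body, ∃ γ ∈ A.satisfying D, q.group.map γ = r.1) ∧ r.2 = α (q.bag D r.1)}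

/-- `N`-equivalence of `α`-queries: equal results over all databases whose carrier has at most `N`
elements. -/
def NEquivalent [LinearOrder I] [Nonempty I] {k : ℕ} {V : Type*}
    (α : Multiset (Fin k → I) → V) (N : ℕ) (q q' : Query I k) : Prop :=
  ∀ D : Database I, D.carrier.card ≤ N → q.result α D = q'.result α D

/-- Entailment `L ⊨ c` over `I`. -/
def Entails [LinearOrder I] (L : List (Comparison I)) (c : Comparison I) : Prop :=
  ∀ δ : ℕ → I, (∀ e ∈ L, e.Holds δ) → c.Holds δ

/-- `L` is a complete ordering of `T` with respect to `I`: a conjunction of comparisons between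
terms of `T` such that for any two terms `t`, `t'` of `T` exactly one of `t < t'`, `t > t'`,
`t = t'` is entailed. -/
def IsCompleteOrdering [LinearOrder I] (L : List (Comparison I)) (T : List (Term I)) : Prop :=
  (∀ c ∈ L, c.lhs ∈ T ∧ c.rhs ∈ T) ∧
  ∀ t ∈ T, ∀ t' ∈ T,
    (Entails L ⟨t, .lt, t'⟩ ∧ ¬ Entails L ⟨t, .gt, t'⟩ ∧ ¬ Entails L ⟨t, .eq, t'⟩) ∨
    (¬ Entails L ⟨t, .lt, t'⟩ ∧ Entails L ⟨t, .gt, t'⟩ ∧ ¬ Entails L ⟨t, .eq, t'⟩) ∨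
    (¬ Entails L ⟨t, .lt, t'⟩ ∧ ¬ Entails L ⟨t, .gt, t'⟩ ∧ Entails L ⟨t, .eq, t'⟩)

/-- The formula is an ordered identity: `L` is a complete ordering of `T`, and the bags consist of
tuples of terms of `T`. -/
def Identity.IsOrdered [LinearOrder I] {k : ℕ} (e : Identity I k) : Prop :=
  IsCompleteOrdering e.L e.T ∧ (∀ s ∈ e.B, ∀ i, s i ∈ e.T) ∧ ∀ s ∈ e.B', ∀ i, s i ∈ e.T

/-- The bag `δ(B)`. -/
def instBag {k : ℕ} (δ : ℕ → I) (B : List (Fin k → Term I)) : Multiset (Fin k → I) :=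
  (B : Multiset (Fin k → Term I)).map fun s i => (s i).eval δ

/-- The formula `L → α(B) = α(B')` is valid: `α(δ(B)) = α(δ(B'))` for every assignment `δ` that
satisfies `L`. -/
def Identity.Valid [LinearOrder I] {k : ℕ} {V : Type*}
    (α : Multiset (Fin k → I) → V) (e : Identity I k) : Prop :=
  ∀ δ : ℕ → I, (∀ c ∈ e.L, c.Holds δ) → α (instBag δ e.B) = α (instBag δ e.B')

end Semantics

/-- `α` is order-decidable over `I`: the set of valid ordered identities for `α` is decidable. -/
def OrderDecidable {I : Type*} [Primcodable I] [LinearOrder I] {k : ℕ} {V : Type*}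
    (α : Multiset (Fin k → I) → V) : Prop :=
  ComputablePred fun e : Identity I k => e.IsOrdered ∧ e.Valid α

/-- The bounded equivalence problem for disjunctive `α`-queries with comparisons ranging over `I`
is decidable: the set of all triples of a positive number `N` and two queries that are
`N`-equivalent is decidable. -/
def BoundedEquivalenceDecidable {I : Type*} [Primcodable I] [LinearOrder I] [Nonempty I] {k : ℕ}
    {V : Type*} (α : Multiset (Fin k → I) → V) : Prop :=
  ComputablePred fun x : ℕ × Query I k × Query I k =>
    0 < x.1 ∧ x.2.1.WellFormed ∧ x.2.2.WellFormed ∧ NEquivalent α x.1 x.2.1 x.2.2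

end AggQuery

/-! ### Bounded quantification over lists -/

section Quantifiers

variable {α β : Type*} [Primcodable α] [Primcodable β]

/-! From order-decidability to bounded equivalence. A query cannot distinguish two databases that
differ by an order-preserving renaming which fixes its constants, so for given `N` only finitely
many situations have to be examined. A situation consists of a strictly increasing list `E` of terms
(all constants of the two queries and at most `N` variables standing for the other carrier
elements), a sublist `K` of terms for the carrier, a list `S` of symbolic atoms over `K`, and a
symbolic group `g`. Because the queries are safe, their assignments take values in `E` only, so both
bags can be computed symbolically, and an instantiation `δ` that respects the order of `E` carries
the symbolic bags to the actual ones (`Query.bag_instDatabase`). Equality of the aggregates for all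
such `δ` is then the validity of one ordered identity.

The order of `I` is not assumed computable. Whether `E` can be strictly increasing in `I` is again
left to the oracle: the identity `chain E → α(∅) = α(∅)` is trivially valid, and it is ordered
exactly when `chain E` is satisfiable (`isCompleteOrdering_chain`). Once `E` is accepted,
comparisons are evaluated on positions in `E`.

From bounded equivalence to order-decidability. For an arbitrary conjunction `L` and bags `B`, `B'`
over variables below `M`, one disjunct per tuple of `B` gives a query that returns the bag `δ(B)`
for the group `δ(0), …, δ(M - 1)` if that tuple is stored in the database and `δ` satisfies `L`, and
nothing otherwise. Equivalence of the queries for `B` and `B'` says that `δ(B)` and `δ(B')` agree as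
query answers for every `δ` satisfying `L` (`nEquivalent_identityQuery`). A one-element bag never
agrees with the empty one, so this decides unsatisfiability of `L`, hence entailment, hence being a
complete ordering. It also decides validity, up to the empty bag, on which a query never evaluates
`α`; `computablePred_valid` deals with that case. -/

theorem PrimrecPred.forall_mem {l : α → List β} {R : α → β → Prop} (hl : Primrec l)
    (hR : PrimrecRel R) : PrimrecPred fun a => ∀ b ∈ l a, R a b :=
  PrimrecRel.comp (hR.swap.forall_mem_list) hl Primrec.id

theorem PrimrecPred.exists_mem {l : α → List β} {R : α → β → Prop} (hl : Primrec l)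
    (hR : PrimrecRel R) : PrimrecPred fun a => ∃ b ∈ l a, R a b :=
  PrimrecRel.comp (hR.swap.exists_mem_list) hl Primrec.id

theorem PrimrecPred.imp {p q : α → Prop} (hp : PrimrecPred p) (hq : PrimrecPred q) :
    PrimrecPred fun a => p a → q a :=
  (hp.not.or hq).of_eq fun _ => imp_iff_not_or.symm

theorem PrimrecPred.iff {p q : α → Prop} (hp : PrimrecPred p) (hq : PrimrecPred q) :
    PrimrecPred fun a => p a ↔ q a :=
  ((hp.imp hq).and (hq.imp hp)).of_eq fun _ => iff_iff_implies_and_implies.symm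

theorem PrimrecPred.mem_list {f : α → β} {l : α → List β} (hf : Primrec f) (hl : Primrec l) :
    PrimrecPred fun a => f a ∈ l a :=
  (PrimrecPred.exists_mem (R := fun a b => b = f a) hl
    (Primrec.eq.comp Primrec.snd (hf.comp Primrec.fst))).of_eq fun _ => by simp

theorem Primrec.list_filter {l : α → List β} {R : α → β → Prop} [∀ a, DecidablePred (R a)]
    (hl : Primrec l) (hR : PrimrecRel R) : Primrec fun a => (l a).filter fun b => R a b := by
  classical
  have h : Primrec₂ fun (L : List β) a => L.filter (fun b => R a b) := by
    convert hR.swap.listFilter using 6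
  exact h.comp hl Primrec.id

theorem ComputablePred.comp {p : β → Prop} {f : α → β} (hp : ComputablePred p)
    (hf : Computable f) : ComputablePred fun a => p (f a) := by
  obtain ⟨_, hp⟩ := hp
  exact ⟨inferInstance, hp.comp hf⟩

theorem ComputablePred.and {p q : α → Prop} (hp : ComputablePred p) (hq : ComputablePred q) :
    ComputablePred fun a => p a ∧ q a := by
  obtain ⟨_, hp⟩ := hp
  obtain ⟨_, hq⟩ := hq
  exact ⟨inferInstance, (Primrec.and.to_comp.comp hp hq).of_eq fun a => by simp⟩

theorem ComputablePred.or {p q : α → Prop} (hp : ComputablePred p) (hq : ComputablePred q) :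
    ComputablePred fun a => p a ∨ q a := by
  obtain ⟨_, hp⟩ := hp
  obtain ⟨_, hq⟩ := hq
  exact ⟨inferInstance, (Primrec.or.to_comp.comp hp hq).of_eq fun a => by simp⟩

theorem ComputablePred.imp {p q : α → Prop} (hp : ComputablePred p) (hq : ComputablePred q) :
    ComputablePred fun a => p a → q a :=
  (hp.not.or hq).of_eq fun _ => imp_iff_not_or.symm

/-- The conjunction over the list is accumulated by recursion on the index; this needs only
computability of the predicate. -/
theorem ComputablePred.forall_mem {l : α → List β} {R : α → β → Prop} (hl : Computable l)
    (hR : ComputablePred fun p : α × β => R p.1 p.2) :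
    ComputablePred fun a => ∀ b ∈ l a, R a b := by
  classical
  obtain ⟨r, hr, hRr⟩ := ComputablePred.computable_iff.1 hR
  -- An index outside the list counts as true, so it does not affect the conjunction.
  let val : α × ℕ → Bool := fun p => Option.casesOn (l p.1)[p.2]? true fun b => r (p.1, b)
  have hR' : Computable₂ fun (p : α × ℕ) (b : β) => r (p.1, b) :=
    Computable.comp (f := r) (g := fun q : (α × ℕ) × β => (q.1.1, q.2)) hr
      ((Computable.fst.comp Computable.fst).pair Computable.snd)
  have hval : Computable val :=
    Computable.option_casesOn
      (Computable.list_getElem?.comp (hl.comp Computable.fst) Computable.snd)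
      (Computable.const true)
      hR'
  have hstep : Computable₂ fun (a : α) (p : ℕ × Bool) => Bool.and p.2 (val (a, p.1)) :=
    Computable₂.comp (f := Bool.and) Primrec.and.to_comp (Computable.snd.comp Computable.snd)
      (hval.comp (Computable.fst.pair (Computable.fst.comp Computable.snd)))
  have hRr (a b) : R a b ↔ r (a, b) = true := iff_of_eq (congrFun hRr (a, b))
  simp only [hRr]
  have h := Computable.nat_rec (Computable.list_length.comp hl) (Computable.const true) hstep
  refine Computable.computablePred (h.of_eq fun a => ?_)
  have key : ∀ n, (Nat.rec true (fun y IH => Bool.and IH (val (a, y))) n : Bool) =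
      decide (∀ i < n, ∀ b, (l a)[i]? = some b → r (a, b)) := by
    intro n
    induction n with
    | zero => simp
    | succ n ih =>
      dsimp only at ih ⊢
      rw [ih, Bool.eq_iff_iff]
      cases h : (l a)[n]? <;>
        simp only [val, h, Bool.and_true, Bool.and_eq_true, decide_eq_true_eq,
          Nat.lt_succ_iff_lt_or_eq] <;>
        constructor
      · rintro h1 i (hi | rfl) b hb
        · exact h1 i hi b hb
        · simp [h] at hb
      · exact fun h1 i hi => h1 i (Or.inl hi)
      · rintro ⟨h1, h2⟩ i (hi | rfl) b hb
        · exact h1 i hi b hb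
        · rw [h, Option.some_inj] at hb
          exact hb ▸ h2
      · exact fun h1 => ⟨fun i hi => h1 i (Or.inl hi), h1 n (Or.inr rfl) _ h⟩
  refine (key _).trans ?_
  rw [Bool.eq_iff_iff, decide_eq_true_eq, decide_eq_true_eq]
  constructor
  · intro h b hb
    obtain ⟨i, hi, rfl⟩ := List.getElem_of_mem hb
    exact h i hi _ (List.getElem?_eq_getElem hi)
  · intro h i _ b hb
    exact h b (List.mem_of_getElem? hb)

end Quantifiers

namespace AggQuery

/-! ### Words over a finite alphabet -/

section Words

variable {β : Type*}

/-- The list of all words of length `n` over the alphabet `l`. -/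
def words (l : List β) : ℕ → List (List β)
  | 0 => [[]]
  | n + 1 => l.flatMap fun a => (words l n).map (a :: ·)

theorem mem_words {l : List β} {n : ℕ} {w : List β} :
    w ∈ words l n ↔ w.length = n ∧ ∀ a ∈ w, a ∈ l := by
  induction n generalizing w with
  | zero => cases w <;> simp [words]
  | succ n ih =>
    cases w with
    | nil => simp [words]
    | cons b w => simp [words, ih]; tauto

theorem nodup_words {l : List β} (hl : l.Nodup) (n : ℕ) : (words l n).Nodup := by
  induction n with
  | zero => simp [words]
  | succ n ih =>
    rw [words, List.nodup_flatMap]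
    refine ⟨fun a _ => ih.map (List.cons_injective), ?_⟩
    refine hl.imp fun {a b} hab => ?_
    simp only [Function.onFun, List.disjoint_left, List.mem_map]
    rintro _ ⟨x, _, rfl⟩ ⟨y, _, h⟩
    exact hab (List.cons.inj h).1.symm

/-- The list of all words of length at most `n` over the alphabet `l`. -/
def wordsLE (l : List β) (n : ℕ) : List (List β) :=
  (List.range (n + 1)).flatMap (words l)

theorem mem_wordsLE {l : List β} {n : ℕ} {w : List β} :
    w ∈ wordsLE l n ↔ w.length ≤ n ∧ ∀ a ∈ w, a ∈ l := by
  simp [wordsLE, mem_words]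

theorem primrec_words [Primcodable β] : Primrec₂ (words (β := β)) := by
  have hstep : Primrec₂ fun (l : List β) (p : ℕ × List (List β)) =>
      l.flatMap fun a => p.2.map (a :: ·) := by
    refine Primrec.list_flatMap Primrec.fst (Primrec.list_map
      (Primrec.snd.comp (Primrec.snd.comp Primrec.fst)) ?_)
    exact Primrec.list_cons.comp (Primrec.snd.comp Primrec.fst) Primrec.snd
  refine Primrec₂.of_eq (Primrec.nat_rec (f := fun _ => [[]]) (Primrec.const [[]]) hstep)
    fun l n => ?_
  induction n with
  | zero => rfl
  | succ n ih => simp only [words, ← ih]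

theorem primrec_wordsLE [Primcodable β] : Primrec₂ (wordsLE (β := β)) :=
  Primrec.list_flatMap (Primrec.list_range.comp (Primrec.succ.comp Primrec.snd))
    (primrec_words.comp (Primrec.fst.comp Primrec.fst) Primrec.snd)

end Words

/-- A strict upper bound for the members of a list of natural numbers. -/
def strictBound (l : List ℕ) : ℕ := l.foldr (fun a b => max (a + 1) b) 0

theorem lt_strictBound {l : List ℕ} {a : ℕ} (h : a ∈ l) : a < strictBound l := by
  induction l with
  | nil => simp at h
  | cons b l ih =>
    simp only [strictBound, List.foldr_cons, lt_max_iff]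
    rcases List.mem_cons.1 h with rfl | h
    · exact Or.inl (Nat.lt_succ_self _)
    · exact Or.inr (ih h)

theorem primrec_strictBound : Primrec strictBound :=
  Primrec.list_foldr (h := fun _ p => max (p.1 + 1) p.2) Primrec.id (Primrec.const 0)
    (Primrec.nat_max.comp (Primrec.succ.comp (Primrec.fst.comp Primrec.snd))
      (Primrec.snd.comp Primrec.snd))

/-! ### Syntactic operations are primitive recursive -/

section PrimrecSyntax

variable {I : Type*} [Primcodable I] {k : ℕ} {σ τ : Type*} [Primcodable σ] [Primcodable τ]

theorem Term.primrec_equiv : Primrec (Term.equiv (I := I)) := Primrec.of_equiv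
theorem Term.primrec_equiv_symm : Primrec (Term.equiv (I := I)).symm := Primrec.of_equiv_symm
theorem Term.primrec_var : Primrec (Term.var : ℕ → Term I) :=
  Term.primrec_equiv_symm.comp Primrec.sumInl
theorem Term.primrec_const : Primrec (Term.const : I → Term I) :=
  Term.primrec_equiv_symm.comp Primrec.sumInr

theorem Term.primrec_cases {t : σ → Term I} {f : σ → ℕ → τ} {g : σ → I → τ} (ht : Primrec t)
    (hf : Primrec₂ f) (hg : Primrec₂ g) :
    Primrec fun a => (match t a with
      | .var v => f a v
      | .const c => g a c : τ) :=
  (Primrec.sumCasesOn (Term.primrec_equiv.comp ht) hf hg).of_eq fun a => by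
    cases h : t a <;> rfl

theorem Comparison.primrec_equiv : Primrec (Comparison.equiv (I := I)) := Primrec.of_equiv
theorem Comparison.primrec_lhs : Primrec (Comparison.lhs (I := I)) :=
  Primrec.fst.comp Comparison.primrec_equiv
theorem Comparison.primrec_op : Primrec (Comparison.op (I := I)) :=
  Primrec.fst.comp (Primrec.snd.comp Comparison.primrec_equiv)
theorem Comparison.primrec_rhs : Primrec (Comparison.rhs (I := I)) :=
  Primrec.snd.comp (Primrec.snd.comp Comparison.primrec_equiv)
theorem Comparison.primrec_mk {s t : σ → Term I} {o : σ → CmpOp} (hs : Primrec s)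
    (ho : Primrec o) (ht : Primrec t) :
    Primrec fun a => (⟨s a, o a, t a⟩ : Comparison I) :=
  (Primrec.of_equiv_symm (e := Comparison.equiv (I := I))).comp (hs.pair (ho.pair ht))

theorem Atom.primrec_equiv : Primrec (Atom.equiv (I := I)) := Primrec.of_equiv
theorem Atom.primrec_pred : Primrec (Atom.pred (I := I)) := Primrec.fst.comp Atom.primrec_equiv
theorem Atom.primrec_args : Primrec (Atom.args (I := I)) := Primrec.snd.comp Atom.primrec_equiv
theorem Atom.primrec_mk {p : σ → ℕ} {l : σ → List (Term I)} (hp : Primrec p) (hl : Primrec l) :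
    Primrec fun a => (⟨p a, l a⟩ : Atom I) :=
  (Primrec.of_equiv_symm (e := Atom.equiv (I := I))).comp (hp.pair hl)

theorem Condition.primrec_equiv : Primrec (Condition.equiv (I := I)) := Primrec.of_equiv
theorem Condition.primrec_pos : Primrec (Condition.pos (I := I)) :=
  Primrec.fst.comp Condition.primrec_equiv
theorem Condition.primrec_neg : Primrec (Condition.neg (I := I)) :=
  Primrec.fst.comp (Primrec.snd.comp Condition.primrec_equiv)
theorem Condition.primrec_cmp : Primrec (Condition.cmp (I := I)) :=
  Primrec.snd.comp (Primrec.snd.comp Condition.primrec_equiv)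
theorem Condition.primrec_mk {p n : σ → List (Atom I)} {c : σ → List (Comparison I)}
    (hp : Primrec p) (hn : Primrec n) (hc : Primrec c) :
    Primrec fun a => (⟨p a, n a, c a⟩ : Condition I) :=
  (Primrec.of_equiv_symm (e := Condition.equiv (I := I))).comp (hp.pair (hn.pair hc))

theorem Query.primrec_equiv : Primrec (Query.equiv (I := I) (k := k)) := Primrec.of_equiv
theorem Query.primrec_group : Primrec (Query.group (I := I) (k := k)) :=
  Primrec.fst.comp Query.primrec_equiv
theorem Query.primrec_agg : Primrec (Query.agg (I := I) (k := k)) :=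
  Primrec.fst.comp (Primrec.snd.comp Query.primrec_equiv)
theorem Query.primrec_body : Primrec (Query.body (I := I) (k := k)) :=
  Primrec.snd.comp (Primrec.snd.comp Query.primrec_equiv)
theorem Query.primrec_mk {g : σ → List ℕ} {y : σ → Fin k → ℕ} {b : σ → List (Condition I)}
    (hg : Primrec g) (hy : Primrec y) (hb : Primrec b) :
    Primrec fun a => (⟨g a, y a, b a⟩ : Query I k) :=
  (Primrec.of_equiv_symm (e := Query.equiv (I := I) (k := k))).comp (hg.pair (hy.pair hb))

theorem Identity.primrec_equiv : Primrec (Identity.equiv (I := I) (k := k)) := Primrec.of_equiv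
theorem Identity.primrec_T : Primrec (Identity.T (I := I) (k := k)) :=
  Primrec.fst.comp Identity.primrec_equiv
theorem Identity.primrec_L : Primrec (Identity.L (I := I) (k := k)) :=
  Primrec.fst.comp (Primrec.snd.comp Identity.primrec_equiv)
theorem Identity.primrec_B : Primrec (Identity.B (I := I) (k := k)) :=
  Primrec.fst.comp (Primrec.snd.comp (Primrec.snd.comp Identity.primrec_equiv))
theorem Identity.primrec_B' : Primrec (Identity.B' (I := I) (k := k)) :=
  Primrec.snd.comp (Primrec.snd.comp (Primrec.snd.comp Identity.primrec_equiv))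
theorem Identity.primrec_mk {T : σ → List (Term I)} {L : σ → List (Comparison I)}
    {B B' : σ → List (Fin k → Term I)} (hT : Primrec T) (hL : Primrec L) (hB : Primrec B)
    (hB' : Primrec B') : Primrec fun a => (⟨T a, L a, B a, B' a⟩ : Identity I k) :=
  (Primrec.of_equiv_symm (e := Identity.equiv (I := I) (k := k))).comp
    (hT.pair (hL.pair (hB.pair hB')))

theorem primrec_apply {s : σ → Fin k → τ} (hs : Primrec s) (i : Fin k) :
    Primrec fun a => s a i :=
  Primrec.fin_app.comp hs (Primrec.const i)

/-- Since `k` is fixed, finitely many component functions can be combined into one. -/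
theorem primrec_tuple {s : σ → Fin k → τ} (hs : ∀ i, Primrec fun a => s a i) : Primrec s :=
  Primrec.fin_curry.2 (Primrec.fin_curry₁.2 hs).swap

theorem Term.primrec_vars : Primrec (Term.vars (I := I)) :=
  (Term.primrec_cases (f := fun _ v => [v]) Primrec.id
    (Primrec.list_cons.comp Primrec.snd (Primrec.const []))
    (g := fun _ _ => []) (Primrec.const [])).of_eq fun t => by cases t <;> rfl

/-- The terms occurring in a condition. -/
def Condition.terms {I : Type*} (A : Condition I) : List (Term I) :=
  (A.pos ++ A.neg).flatMap Atom.args ++ A.cmp.flatMap fun c => [c.lhs, c.rhs]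

theorem Condition.primrec_terms : Primrec (Condition.terms (I := I)) :=
  Primrec.list_append.comp
    (Primrec.list_flatMap
      (Primrec.list_append.comp Condition.primrec_pos Condition.primrec_neg)
      (Atom.primrec_args.comp₂ Primrec₂.right))
    (Primrec.list_flatMap Condition.primrec_cmp
      (Primrec.list_cons.comp (Comparison.primrec_lhs.comp Primrec.snd)
        (Primrec.list_cons.comp (Comparison.primrec_rhs.comp Primrec.snd) (Primrec.const []))))

theorem Condition.vars_eq {I : Type*} (A : Condition I) :
    A.vars = A.terms.flatMap Term.vars := by
  simp [Condition.vars, Condition.terms, List.flatMap_assoc]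

theorem Condition.primrec_vars : Primrec (Condition.vars (I := I)) :=
  (Primrec.list_flatMap Condition.primrec_terms (Term.primrec_vars.comp₂ Primrec₂.right)).of_eq
    fun A => A.vars_eq.symm

end PrimrecSyntax

end AggQuery

namespace AggQuery

/-! ### Strictly increasing lists of terms as complete orderings. -/

section Chain

variable {I : Type*}

/-- The conjunction of comparisons expressing that the list of terms is strictly increasing. -/
def chain (E : List (Term I)) : List (Comparison I) :=
  (List.range E.length).flatMap fun i => (List.range i).map fun j =>
    -- Both indices are smaller than the length of `E`, so the default is never used.
    ⟨E.getD j (.var 0), .lt, E.getD i (.var 0)⟩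

theorem chain_mem {E : List (Term I)} {c : Comparison I} (hc : c ∈ chain E) :
    c.lhs ∈ E ∧ c.rhs ∈ E := by
  simp only [chain, List.mem_flatMap, List.mem_map, List.mem_range] at hc
  obtain ⟨i, hi, j, hj, rfl⟩ := hc
  exact ⟨by simp [hj.trans hi], by simp [hi]⟩

variable [LinearOrder I]

theorem chain_holds {E : List (Term I)} {δ : ℕ → I} :
    (∀ c ∈ chain E, c.Holds δ) ↔ (E.map (Term.eval δ)).Pairwise (· < ·) := by
  simp only [chain, List.mem_flatMap, List.mem_map, List.mem_range, List.pairwise_iff_getElem,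
    List.length_map, List.getElem_map]
  constructor
  · intro h i j hi hj hij
    simpa [Comparison.Holds, CmpOp.Holds, hi, hj] using h _ ⟨j, hj, i, hij, rfl⟩
  · rintro h _ ⟨i, hi, j, hj, rfl⟩
    simpa [Comparison.Holds, CmpOp.Holds, hi, hj.trans hi] using h j i (hj.trans hi) hi hj

/-- A satisfiable chain fixes the relation between any two of its terms. An unsatisfiable one
entails everything, so "exactly one" fails. Through this equivalence the oracle for ordered
identities decides satisfiability of chains in `I`. -/
theorem isCompleteOrdering_chain [Nonempty I] {E : List (Term I)} :
    IsCompleteOrdering (chain E) E ↔ ∃ δ : ℕ → I, (E.map (Term.eval δ)).Pairwise (· < ·) := by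
  constructor
  · rintro ⟨-, h⟩
    by_contra hn
    have hall (c : Comparison I) : Entails (chain E) c := fun δ hδ =>
      (hn ⟨δ, chain_holds.1 hδ⟩).elim
    cases E with
    -- The empty chain holds under any assignment, so an unsatisfiable chain has a term on which
    -- completeness can be refuted.
    | nil => exact hn ⟨fun _ => Classical.arbitrary I, by simp⟩
    | cons t E => simpa [hall] using h t (by simp) t (by simp)
  · rintro ⟨δ₀, h₀⟩
    refine ⟨fun c hc => chain_mem hc, fun t ht t' ht' => ?_⟩
    obtain ⟨i, hi, rfl⟩ := List.getElem_of_mem ht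
    obtain ⟨j, hj, rfl⟩ := List.getElem_of_mem ht'
    have key {i j : ℕ} (hi : i < E.length) (hj : j < E.length) (hij : i < j) (δ : ℕ → I)
        (hδ : ∀ c ∈ chain E, c.Holds δ) : E[i].eval δ < E[j].eval δ := by
      have := List.pairwise_iff_getElem.1 (chain_holds.1 hδ) i j (by simpa) (by simpa) hij
      simpa only [List.getElem_map] using this
    have hδ₀ := chain_holds.2 h₀
    rcases lt_trichotomy i j with hij | rfl | hij
    · exact Or.inl ⟨key hi hj hij, fun h => (h δ₀ hδ₀).not_gt (key hi hj hij δ₀ hδ₀),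
        fun h => (key hi hj hij δ₀ hδ₀).ne (h δ₀ hδ₀)⟩
    · exact Or.inr (Or.inr ⟨fun h => lt_irrefl _ (h δ₀ hδ₀), fun h => lt_irrefl _ (h δ₀ hδ₀),
        fun _ _ => rfl⟩)
    · exact Or.inr (Or.inl ⟨fun h => (h δ₀ hδ₀).not_gt (key hj hi hij δ₀ hδ₀), key hj hi hij,
        fun h => (key hj hi hij δ₀ hδ₀).ne' (h δ₀ hδ₀)⟩)

theorem eval_injOn {E : List (Term I)} {δ : ℕ → I}
    (hE : (E.map (Term.eval δ)).Pairwise (· < ·)) {s t : Term I} (hs : s ∈ E) (ht : t ∈ E)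
    (h : s.eval δ = t.eval δ) : s = t :=
  List.inj_on_of_nodup_map (hE.imp fun h => h.ne) hs ht h

theorem map_eval_inj {E : List (Term I)} {δ : ℕ → I}
    (hE : (E.map (Term.eval δ)).Pairwise (· < ·)) {l l' : List (Term I)} (hl : ∀ t ∈ l, t ∈ E)
    (hl' : ∀ t ∈ l', t ∈ E) : l.map (Term.eval δ) = l'.map (Term.eval δ) ↔ l = l' := by
  refine ⟨fun h => ?_, fun h => h ▸ rfl⟩
  induction l generalizing l' with
  | nil => exact (List.map_eq_nil_iff.1 h.symm).symm
  | cons t l ih =>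
    cases l' with
    | nil => simp at h
    | cons t' l' =>
      simp only [List.map_cons, List.cons.injEq] at h
      simp only [List.mem_cons, forall_eq_or_imp] at hl hl'
      rw [eval_injOn hE hl.1 hl'.1 h.1, ih hl.2 hl'.2 h.2]

open scoped Classical in
theorem idxOf_lt_idxOf_iff {E : List (Term I)} {δ : ℕ → I}
    (hE : (E.map (Term.eval δ)).Pairwise (· < ·)) {s t : Term I} (hs : s ∈ E) (ht : t ∈ E) :
    E.idxOf s < E.idxOf t ↔ s.eval δ < t.eval δ := by
  have key {s t : Term I} (hs : s ∈ E) (ht : t ∈ E) (h : E.idxOf s < E.idxOf t) :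
      s.eval δ < t.eval δ := by
    have := List.pairwise_iff_getElem.1 hE (E.idxOf s) (E.idxOf t)
      (by simpa using List.idxOf_lt_length_of_mem hs)
      (by simpa using List.idxOf_lt_length_of_mem ht) h
    simpa using this
  refine ⟨key hs ht, fun h => ?_⟩
  by_contra hn
  rcases (not_lt.1 hn).lt_or_eq with hlt | heq
  · exact h.not_gt (key ht hs hlt)
  · rw [List.idxOf_inj ht] at heq
    exact h.ne' (heq ▸ rfl)

-- Comparisons between values become comparisons between positions in `E`, which are natural numbers
-- and do not depend on `δ`. Hence comparisons can be evaluated without computing with the order of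
-- `I`.
open scoped Classical in
theorem holds_idxOf_iff {E : List (Term I)} {δ : ℕ → I}
    (hE : (E.map (Term.eval δ)).Pairwise (· < ·)) {s t : Term I} (hs : s ∈ E) (ht : t ∈ E)
    (o : CmpOp) : o.Holds (E.idxOf s) (E.idxOf t) ↔ o.Holds (s.eval δ) (t.eval δ) := by
  have h₁ := idxOf_lt_idxOf_iff hE hs ht
  have h₂ := idxOf_lt_idxOf_iff hE ht hs
  cases o <;> simp only [CmpOp.Holds, gt_iff_lt, ge_iff_le, ne_eq, le_antisymm_iff, h₁, h₂,
    ← not_lt]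

end Chain

/-! ### Symbolic evaluation of queries and its correctness under instantiation. -/

section Symbolic

variable {I : Type*}

/-- The value of a term under the symbolic assignment that maps the variable `v` to the `v`-th term
of the list `w`. -/
def Term.subst (w : List (Term I)) : Term I → Term I
  | .var v => w.getD v (.var 0)
  | .const c => .const c

open scoped Classical in
/-- The symbolic assignment `w` satisfies `A` over the symbolic database `S`, if the terms are
ordered as in the list `E`. -/
def Condition.SymHolds (A : Condition I) (S : List (ℕ × List (Term I))) (E w : List (Term I)) :
    Prop :=
  (∀ a ∈ A.pos, (a.pred, a.args.map (Term.subst w)) ∈ S) ∧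
  (∀ a ∈ A.neg, (a.pred, a.args.map (Term.subst w)) ∉ S) ∧
  ∀ c ∈ A.cmp, c.op.Holds (E.idxOf (c.lhs.subst w)) (E.idxOf (c.rhs.subst w))

/-- Symbolic version of `Condition.satisfying`; the variable `0` is the dummy value. -/
def Condition.SymSatisfies (A : Condition I) (S : List (ℕ × List (Term I)))
    (E w : List (Term I)) : Prop :=
  (∀ v ∈ List.range (strictBound A.vars), (v ∈ A.vars → w.getD v (.var 0) ∈ E) ∧
    (v ∉ A.vars → w.getD v (.var 0) = .var 0)) ∧ A.SymHolds S E w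

open scoped Classical in
/-- The symbolic assignments that satisfy `A` and map the variables `x` to `g`. -/
noncomputable def Condition.symAssignments (A : Condition I) (S : List (ℕ × List (Term I)))
    (E : List (Term I)) (x : List ℕ) (g : List (Term I)) : List (List (Term I)) :=
  (words (.var 0 :: E) (strictBound A.vars)).filter fun w =>
    A.SymSatisfies S E w ∧ (x.map fun v => w.getD v (.var 0)) = g

/-- Symbolic version of `Query.bag`. -/
noncomputable def Query.symBag {k : ℕ} (q : Query I k) (E : List (Term I))
    (S : List (ℕ × List (Term I))) (g : List (Term I)) : List (Fin k → Term I) :=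
  q.body.flatMap fun A => (A.symAssignments S E q.group g).map fun w i =>
    w.getD (q.agg i) (.var 0)

theorem Condition.mem_vars {A : Condition I} {v : ℕ} : v ∈ A.vars ↔ Term.var v ∈ A.terms := by
  rw [A.vars_eq, List.mem_flatMap]
  constructor
  · rintro ⟨t, ht, hv⟩
    cases t with
    | var u => simp only [Term.vars, List.mem_singleton] at hv; exact hv ▸ ht
    | const c => simp [Term.vars] at hv
  · exact fun h => ⟨_, h, by simp [Term.vars]⟩

theorem mem_terms_of_mem_pos {A : Condition I} {a : Atom I} (ha : a ∈ A.pos) {t : Term I}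
    (ht : t ∈ a.args) : t ∈ A.terms :=
  List.mem_append_left _ (List.mem_flatMap.2 ⟨a, List.mem_append_left _ ha, ht⟩)

theorem mem_terms_of_mem_neg {A : Condition I} {a : Atom I} (ha : a ∈ A.neg) {t : Term I}
    (ht : t ∈ a.args) : t ∈ A.terms :=
  List.mem_append_left _ (List.mem_flatMap.2 ⟨a, List.mem_append_right _ ha, ht⟩)

theorem mem_terms_of_mem_cmp {A : Condition I} {c : Comparison I} (hc : c ∈ A.cmp) :
    c.lhs ∈ A.terms ∧ c.rhs ∈ A.terms :=
  ⟨List.mem_append_right _ (List.mem_flatMap.2 ⟨c, hc, by simp⟩),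
    List.mem_append_right _ (List.mem_flatMap.2 ⟨c, hc, by simp⟩)⟩

theorem Condition.subst_mem {A : Condition I} {E w : List (Term I)}
    (hC : ∀ c, Term.const c ∈ A.terms → Term.const c ∈ E)
    (hw : ∀ v ∈ A.vars, w.getD v (.var 0) ∈ E) {t : Term I} (ht : t ∈ A.terms) :
    t.subst w ∈ E := by
  cases t with
  | var v => exact hw v (mem_vars.2 ht)
  | const c => exact hC c ht

/-- The bound on variables in `SymSatisfies` is there for computability only: beyond the length of
`w` no variable of `A` occurs, and the default entry there equals the dummy `.var 0`. -/
theorem Condition.mem_symAssignments {A : Condition I} {E w : List (Term I)}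
    {S : List (ℕ × List (Term I))} {x : List ℕ}
    {g : List (Term I)} : w ∈ A.symAssignments S E x g ↔
      w.length = strictBound A.vars ∧ (∀ v ∈ A.vars, w.getD v (.var 0) ∈ E) ∧
      (∀ v ∉ A.vars, w.getD v (.var 0) = .var 0) ∧ A.SymHolds S E w ∧
      (x.map fun v => w.getD v (.var 0)) = g := by
  classical
  rw [symAssignments, List.mem_filter, decide_eq_true_iff, mem_words]
  simp only [SymSatisfies, List.mem_range]
  constructor
  · rintro ⟨⟨hl, -⟩, ⟨h, hs⟩, hx⟩
    refine ⟨hl, fun v hv => (h v (lt_strictBound hv)).1 hv, fun v hv => ?_, hs, hx⟩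
    by_cases hb : v < strictBound A.vars
    · exact (h v hb).2 hv
    · exact List.getD_eq_default _ _ (by omega)
  · rintro ⟨hl, h₁, h₂, hs, hx⟩
    refine ⟨⟨hl, fun t ht => ?_⟩, ⟨fun v _ => ⟨h₁ v, h₂ v⟩, hs⟩, hx⟩
    obtain ⟨v, hv, rfl⟩ := List.getElem_of_mem ht
    rw [← List.getD_eq_getElem (d := .var 0) _ hv]
    by_cases h : v ∈ A.vars
    · exact List.mem_cons_of_mem _ (h₁ v h)
    · rw [h₂ v h]
      exact List.mem_cons_self

open scoped Classical in
/-- The assignment of the variables of `A` denoted by a symbolic assignment. -/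
noncomputable def Condition.instAssignment [Nonempty I] (A : Condition I) (δ : ℕ → I)
    (w : List (Term I)) : ℕ → I :=
  fun v => if v ∈ A.vars then (w.getD v (.var 0)).eval δ else Classical.arbitrary I

theorem Condition.eval_instAssignment [Nonempty I] {A : Condition I} {w : List (Term I)}
    {δ : ℕ → I} {t : Term I} (ht : t ∈ A.terms) :
    t.eval (A.instAssignment δ w) = (t.subst w).eval δ := by
  cases t with
  | var v => simp only [Term.eval, Term.subst, instAssignment, if_pos (mem_vars.2 ht)]
  | const c => rfl

variable [LinearOrder I]

/-- The database obtained from a symbolic database by an assignment. -/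
def instDatabase (δ : ℕ → I) (S : List (ℕ × List (Term I))) : Database I :=
  (S.map fun a => (a.1, a.2.map (Term.eval δ))).toFinset

/-- By induction on the derivation of `Limited`: a value comes from a positive atom, from a
constant, or is inherited along an equality. Safety thereby confines assignments to values that the
terms of `E` can name. -/
theorem Condition.Safe.value_mem [Nonempty I] {A : Condition I} (hA : A.Safe) {D : Database I}
    {γ : ℕ → I} (hγ : γ ∈ A.satisfying D) {v : ℕ} (hv : v ∈ A.vars) :
    γ v ∈ D.carrier ∨ Term.const (γ v) ∈ A.terms := by
  have key : ∀ v, A.Limited v → γ v ∈ D.carrier ∨ Term.const (γ v) ∈ A.terms := by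
    intro v hv
    induction hv with
    | @pos v a ha hv =>
      refine Or.inl (Finset.mem_biUnion.2 ⟨_, hγ.2.1 a ha, ?_⟩)
      simpa using ⟨_, hv, rfl⟩
    | @const v c h =>
      have hc : γ v = c := by
        rcases h with h | h
        · exact hγ.2.2.2 _ h
        · exact (hγ.2.2.2 _ h).symm
      refine Or.inr (List.mem_append_right _ (List.mem_flatMap.2 ?_))
      rcases h with h | h <;> exact ⟨_, h, by simp [hc]⟩
    | @eq v w hw h ih =>
      have hc : γ v = γ w := by
        rcases h with h | h
        · exact hγ.2.2.2 _ h
        · exact (hγ.2.2.2 _ h).symm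
      rw [hc]; exact ih
  exact key v (hA v hv)

/-- Distinct terms of `E` have distinct values under `δ`, so instantiation does not identify atoms
over `E`. -/
theorem mem_instDatabase {E : List (Term I)} {δ : ℕ → I}
    (hE : (E.map (Term.eval δ)).Pairwise (· < ·)) {S : List (ℕ × List (Term I))}
    (hS : ∀ a ∈ S, ∀ t ∈ a.2, t ∈ E) {p : ℕ} {l : List (Term I)} (hl : ∀ t ∈ l, t ∈ E) :
    (p, l.map (Term.eval δ)) ∈ instDatabase δ S ↔ (p, l) ∈ S := by
  simp only [instDatabase, List.mem_toFinset, List.mem_map, Prod.mk.injEq]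
  constructor
  · rintro ⟨⟨p', l'⟩, ha, rfl, h⟩
    obtain rfl := (map_eval_inj hE (hS _ ha) hl).1 h
    exact ha
  · exact fun h => ⟨_, h, rfl, rfl⟩

theorem mem_of_value_mem_carrier {E : List (Term I)} {δ : ℕ → I} {S : List (ℕ × List (Term I))}
    (hS : ∀ a ∈ S, ∀ t ∈ a.2, t ∈ E) {x : I} (hx : x ∈ (instDatabase δ S).carrier) :
    ∃ t ∈ E, t.eval δ = x := by
  simp only [Database.carrier, instDatabase, Finset.mem_biUnion, List.mem_toFinset,
    List.mem_map] at hx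
  obtain ⟨_, ⟨a, ha, rfl⟩, hx⟩ := hx
  obtain ⟨t, ht, rfl⟩ := List.mem_map.1 hx
  exact ⟨t, hS a ha t ht, rfl⟩

section Assignment

variable [Nonempty I] {A : Condition I} {E w : List (Term I)} {δ : ℕ → I}

theorem Condition.holds_instAssignment {S : List (ℕ × List (Term I))}
    (hE : (E.map (Term.eval δ)).Pairwise (· < ·)) (hS : ∀ a ∈ S, ∀ t ∈ a.2, t ∈ E)
    (hC : ∀ c, Term.const c ∈ A.terms → Term.const c ∈ E)
    (hw : ∀ v ∈ A.vars, w.getD v (.var 0) ∈ E) :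
    A.Holds (instDatabase δ S) (A.instAssignment δ w) ↔ A.SymHolds S E w := by
  have hatom {a : Atom I} (ha : ∀ t ∈ a.args, t ∈ A.terms) :
      a.Holds (instDatabase δ S) (A.instAssignment δ w) ↔
        (a.pred, a.args.map (Term.subst w)) ∈ S := by
    rw [← mem_instDatabase hE hS, List.map_map, Atom.Holds]
    · rw [List.map_congr_left fun t ht => eval_instAssignment (ha t ht)]
      rfl
    · simp only [List.mem_map]
      rintro _ ⟨t, ht, rfl⟩
      exact subst_mem hC hw (ha t ht)
  refine and_congr (forall₂_congr fun a ha => hatom fun t => mem_terms_of_mem_pos ha)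
    (and_congr (forall₂_congr fun a ha => not_congr (hatom fun t => mem_terms_of_mem_neg ha))
      (forall₂_congr fun c hc => ?_))
  obtain ⟨h₁, h₂⟩ := mem_terms_of_mem_cmp hc
  rw [Comparison.Holds, eval_instAssignment h₁, eval_instAssignment h₂,
    holds_idxOf_iff hE (subst_mem hC hw h₁) (subst_mem hC hw h₂)]

/-- Each satisfying assignment arises from a symbolic one, because safety makes every value the
value of a term of `E`. With `Condition.injOn_instAssignment` this is a bijection, so multiplicities
in bags are preserved. -/
theorem Condition.image_symAssignments {S : List (ℕ × List (Term I))} {x : List ℕ}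
    {g : List (Term I)} (hA : A.Safe) (hx : ∀ v ∈ x, v ∈ A.vars)
    (hE : (E.map (Term.eval δ)).Pairwise (· < ·)) (hS : ∀ a ∈ S, ∀ t ∈ a.2, t ∈ E)
    (hg : ∀ t ∈ g, t ∈ E) (hC : ∀ c, Term.const c ∈ A.terms → Term.const c ∈ E) :
    {γ | γ ∈ A.satisfying (instDatabase δ S) ∧ x.map γ = g.map (Term.eval δ)} =
      A.instAssignment δ '' {w | w ∈ A.symAssignments S E x g} := by
  have hgroup {w : List (Term I)} (hw : ∀ v ∈ A.vars, w.getD v (.var 0) ∈ E) :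
      x.map (A.instAssignment δ w) = g.map (Term.eval δ) ↔
        (x.map fun v => w.getD v (.var 0)) = g := by
    rw [← map_eval_inj hE (fun t ht => ?_) hg, List.map_map]
    · rw [List.map_congr_left (g := Term.eval δ ∘ fun v => w.getD v (.var 0))]
      intro v hv
      simp [instAssignment, hx v hv]
    · obtain ⟨v, hv, rfl⟩ := List.mem_map.1 ht
      exact hw v (hx v hv)
  ext γ
  simp only [Set.mem_ofPred_eq, Set.mem_image, mem_symAssignments]
  constructor
  · rintro ⟨hγ, hd⟩
    have hval (v : ℕ) (hv : v ∈ A.vars) : ∃ t ∈ E, t.eval δ = γ v := by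
      rcases hA.value_mem hγ hv with h | h
      · exact mem_of_value_mem_carrier hS h
      · exact ⟨_, hC _ h, rfl⟩
    have : Nonempty (Term I) := ⟨.var 0⟩
    choose! f hfE hf using hval
    classical
    -- The word tabulates terms naming the values of `γ`, with the dummy at indices that are not
    -- variables of `A`.
    let w : List (Term I) := (List.range (strictBound A.vars)).map fun v =>
      if v ∈ A.vars then f v else .var 0
    have hw (v : ℕ) : w.getD v (.var 0) = if v ∈ A.vars then f v else .var 0 := by
      by_cases hb : v < strictBound A.vars
      · rw [List.getD_eq_getElem _ _ (by simpa [w] using hb)]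
        simp [w]
      · rw [List.getD_eq_default _ _ (by simpa [w] using hb), if_neg]
        exact fun hv => hb (lt_strictBound hv)
    have hwE : ∀ v ∈ A.vars, w.getD v (.var 0) ∈ E := fun v hv => by
      rw [hw, if_pos hv]; exact hfE v hv
    have hγw : A.instAssignment δ w = γ := by
      funext v
      by_cases hv : v ∈ A.vars
      · simp only [instAssignment, if_pos hv, hw, hf v hv]
      · simp only [instAssignment, if_neg hv, hγ.1 v hv]
    refine ⟨w, ⟨by simp [w], hwE, fun v hv => by rw [hw, if_neg hv], ?_, ?_⟩, hγw⟩
    · rw [← holds_instAssignment hE hS hC hwE, hγw]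
      exact hγ.2
    · rw [← hgroup hwE, hγw, hd]
  · rintro ⟨w, ⟨-, hw, -, hs, hwg⟩, rfl⟩
    exact ⟨⟨fun v hv => if_neg hv, (holds_instAssignment hE hS hC hw).2 hs⟩, (hgroup hw).2 hwg⟩

theorem Condition.injOn_instAssignment {S : List (ℕ × List (Term I))} {x : List ℕ}
    {g : List (Term I)} (hE : (E.map (Term.eval δ)).Pairwise (· < ·)) :
    Set.InjOn (A.instAssignment δ) {w | w ∈ A.symAssignments S E x g} := by
  intro w hw w' hw' h
  simp only [Set.mem_ofPred_eq, mem_symAssignments] at hw hw'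
  have hD (v : ℕ) : w.getD v (.var 0) = w'.getD v (.var 0) := by
    by_cases hv : v ∈ A.vars
    · refine eval_injOn hE (hw.2.1 v hv) (hw'.2.1 v hv) ?_
      simpa only [instAssignment, if_pos hv] using congrFun h v
    · rw [hw.2.2.1 v hv, hw'.2.2.1 v hv]
  refine List.ext_getElem (hw.1.trans hw'.1.symm) fun v h₁ h₂ => ?_
  rw [← List.getD_eq_getElem (d := .var 0) _ h₁, ← List.getD_eq_getElem (d := .var 0) _ h₂, hD]

end Assignment

theorem sum_map_singleton_coe {β τ : Type*} (l : List β) (f : β → τ) :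
    (l.map fun b => ({f b} : Multiset τ)).sum = (l.map f : Multiset τ) := by
  induction l with
  | nil => rfl
  | cons b l ih => simp [ih]

/-- The sum over satisfying assignments is reindexed by symbolic ones. A single symbolic bag,
computed without `δ`, thus describes the answers for all order-respecting `δ` at once. -/
theorem Query.bag_instDatabase [Nonempty I] {k : ℕ} {q : Query I k} (hq : q.WellFormed)
    {E g : List (Term I)} {S : List (ℕ × List (Term I))} {δ : ℕ → I}
    (hE : (E.map (Term.eval δ)).Pairwise (· < ·)) (h0 : Term.var 0 ∉ E)
    (hS : ∀ a ∈ S, ∀ t ∈ a.2, t ∈ E) (hg : ∀ t ∈ g, t ∈ E)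
    (hC : ∀ A ∈ q.body, ∀ c, Term.const c ∈ A.terms → Term.const c ∈ E) :
    q.bag (instDatabase δ S) (g.map (Term.eval δ)) = instBag δ (q.symBag E S g) := by
  classical
  -- As the dummy lies outside `E`, the enumeration of words has no repetitions and each assignment
  -- is counted once.
  have hnd : (Term.var 0 :: E).Nodup :=
    List.nodup_cons.2 ⟨h0, List.Nodup.of_map _ (hE.imp fun h => h.ne)⟩
  have key : ∀ A ∈ q.body,
      (∑ᶠ γ ∈ {γ | γ ∈ A.satisfying (instDatabase δ S) ∧ q.group.map γ = g.map (Term.eval δ)},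
        ({fun i => γ (q.agg i)} : Multiset (Fin k → I))) =
      instBag δ ((A.symAssignments S E q.group g).map fun w i => w.getD (q.agg i) (.var 0)) := by
    intro A hA
    obtain ⟨hs, hx, hy⟩ := hq A hA
    rw [Condition.image_symAssignments hs hx hE hS hg (hC A hA),
      finsum_mem_image (Condition.injOn_instAssignment hE)]
    have hset : {w | w ∈ A.symAssignments S E q.group g} =
        ((A.symAssignments S E q.group g).toFinset : Set (List (Term I))) := by
      ext; simp
    have hnd' : (A.symAssignments S E q.group g).Nodup := (nodup_words hnd _).filter _
    rw [hset, finsum_mem_coe_finset, List.sum_toFinset _ hnd',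
      sum_map_singleton_coe]
    simp only [instBag, Multiset.map_coe, List.map_map]
    congr 1
    refine List.map_congr_left fun w hw => ?_
    funext i
    simp [Condition.instAssignment, hy i]
  rw [Query.bag, List.map_congr_left key, Query.symBag]
  generalize q.body = l
  induction l with
  | nil => rfl
  | cons A l ih =>
    rw [List.map_cons, List.sum_cons, ih, List.flatMap_cons]
    simp only [instBag, Multiset.map_coe, List.map_append, Multiset.coe_add]

end Symbolic

end AggQuery

namespace AggQuery

/-! ### Query results in terms of bags. -/

section Results

variable {I : Type*} [LinearOrder I] [Nonempty I] {k : ℕ} {V : Type*}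

/-- Every satisfying assignment in the group contributes a singleton and there are finitely many of
them, so nothing cancels. The groups that occur in a result can therefore be read off the bags. -/
theorem Query.WellFormed.bag_eq_zero_iff {q : Query I k} (hq : q.WellFormed) (D : Database I)
    (d : List I) :
    q.bag D d = 0 ↔ ∀ A ∈ q.body, ∀ γ ∈ A.satisfying D, q.group.map γ ≠ d := by
  simp only [Query.bag, List.sum_eq_zero_iff, List.mem_map, forall_exists_index, and_imp,
    forall_apply_eq_imp_iff₂]
  refine forall₂_congr fun A hA => ?_
  have hfin : {γ | γ ∈ A.satisfying D ∧ q.group.map γ = d}.Finite :=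
    ((hq A hA).1.finite_satisfying D).subset fun _ h => h.1
  rw [finsum_mem_eq_finite_toFinset_sum _ hfin, Finset.sum_eq_zero_iff]
  simp

theorem Query.WellFormed.mem_result {q : Query I k} (hq : q.WellFormed)
    (α : Multiset (Fin k → I) → V) (D : Database I) (r : List I × V) :
    r ∈ q.result α D ↔ q.bag D r.1 ≠ 0 ∧ r.2 = α (q.bag D r.1) := by
  rw [Ne, hq.bag_eq_zero_iff]
  simp [Query.result]

/-- Two bags yield the same entry of a query result: no entry if both bags are empty, and the same
aggregate otherwise. -/
def BagAgree (α : Multiset (Fin k → I) → V) (B B' : Multiset (Fin k → I)) : Prop :=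
  (B = 0 ↔ B' = 0) ∧ (B ≠ 0 → α B = α B')

theorem nEquivalent_iff {α : Multiset (Fin k → I) → V} {N : ℕ} {q q' : Query I k}
    (hq : q.WellFormed) (hq' : q'.WellFormed) :
    NEquivalent α N q q' ↔
      ∀ D : Database I, D.carrier.card ≤ N → ∀ d, BagAgree α (q.bag D d) (q'.bag D d) := by
  refine forall₂_congr fun D _ => ?_
  simp only [Set.ext_iff, hq.mem_result, hq'.mem_result, Prod.forall, BagAgree]
  refine forall_congr' fun d => ?_
  constructor
  · intro h
    have h₁ := h (α (q.bag D d))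
    have h₂ := h (α (q'.bag D d))
    simp only [and_true] at h₁ h₂
    refine ⟨not_iff_not.1 ⟨fun h => (h₁.1 h).1, fun h => (h₂.2 h).1⟩, fun h => (h₁.1 h).2⟩
  · rintro ⟨h₁, h₂⟩ v
    rw [Ne, h₁]
    refine and_congr_right fun h => ?_
    rw [h₂ (mt h₁.1 h)]

end Results

/-! ### Reduction of `N`-equivalence to finitely many ordered identities. -/

section Decision

variable {I : Type*} {k : ℕ} {V : Type*}

/-- The constants occurring in a term. -/
def Term.consts : Term I → List I
  | .var _ => []
  | .const c => [c]

theorem Term.mem_consts {t : Term I} {c : I} : c ∈ t.consts ↔ t = .const c := by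
  cases t <;> simp [Term.consts, eq_comm]

/-- The constants occurring in a query. -/
def Query.consts (q : Query I k) : List I :=
  q.body.flatMap fun A => A.terms.flatMap Term.consts

theorem Query.mem_consts {q : Query I k} {c : I} :
    c ∈ q.consts ↔ ∃ A ∈ q.body, Term.const c ∈ A.terms := by
  simp [Query.consts, Term.mem_consts]

/-- The relational atoms occurring in a query. -/
def Query.atoms (q : Query I k) : List (Atom I) :=
  q.body.flatMap fun A => A.pos ++ A.neg

/-- The terms used to represent the elements of a carrier of size at most `N` and the constants
in `C`. -/
def alphabet (N : ℕ) (C : List I) : List (Term I) :=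
  (List.range N).map (fun v => .var (v + 1)) ++ C.map .const

/-- The shift by one in `alphabet` reserves variable `0` for the dummy value. -/
theorem var_zero_notMem_alphabet (N : ℕ) (C : List I) : Term.var 0 ∉ alphabet N C := by
  simp [alphabet]

/-- The symbolic ground atoms over `K` that match one of the given atoms. -/
def atomPool (K : List (Term I)) (l : List (Atom I)) : List (ℕ × List (Term I)) :=
  l.flatMap fun a => (words K a.args.length).map fun w => (a.pred, w)

theorem mem_atomPool {K : List (Term I)} {l : List (Atom I)} {b : ℕ × List (Term I)} :
    b ∈ atomPool K l ↔
      (∃ a ∈ l, a.pred = b.1 ∧ a.args.length = b.2.length) ∧ ∀ t ∈ b.2, t ∈ K := by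
  obtain ⟨p, w⟩ := b
  simp only [atomPool, List.mem_flatMap, List.mem_map, mem_words, Prod.mk.injEq]
  constructor
  · rintro ⟨a, ha, w', ⟨hl, hw⟩, rfl, rfl⟩
    exact ⟨⟨a, ha, rfl, hl.symm⟩, hw⟩
  · rintro ⟨⟨a, ha, rfl, hl⟩, hw⟩
    exact ⟨a, ha, w, ⟨hl.symm, hw⟩, rfl, rfl⟩

/-- Symbolic `N`-equivalence, relative to a predicate `P` that tells which ordered identities are
valid. -/
def SymEquivalent (P : Identity I k → Prop) (N : ℕ) (q q' : Query I k) : Prop :=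
  ∀ E ∈ wordsLE (alphabet N (q.consts ++ q'.consts)) (N + (q.consts ++ q'.consts).length),
    -- For the intended `P`, the identity with two empty bags is trivially valid, so this premise
    -- only tests whether `chain E` is a complete ordering.
    (∀ c ∈ q.consts ++ q'.consts, Term.const c ∈ E) → P ⟨E, chain E, [], []⟩ →
    ∀ K ∈ wordsLE E N,
    -- Lists no longer than the pool already represent all of its subsets.
    ∀ S ∈ wordsLE (atomPool K (q.atoms ++ q'.atoms)) (atomPool K (q.atoms ++ q'.atoms)).length,
    ∀ g ∈ wordsLE E (q.group.length + q'.group.length),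
      (q.symBag E S g = [] ↔ q'.symBag E S g = []) ∧
      (q.symBag E S g ≠ [] → P ⟨E, chain E, q.symBag E S g, q'.symBag E S g⟩)

theorem Query.symBag_mem {q : Query I k} (hq : q.WellFormed) {E : List (Term I)}
    {S : List (ℕ × List (Term I))} {g : List (Term I)} {s : Fin k → Term I}
    (hs : s ∈ q.symBag E S g) (i : Fin k) : s i ∈ E := by
  simp only [Query.symBag, List.mem_flatMap, List.mem_map, Condition.mem_symAssignments] at hs
  obtain ⟨A, hA, w, ⟨-, hw, -⟩, rfl⟩ := hs
  exact hw _ ((hq A hA).2.2 i)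

theorem instBag_eq_zero {δ : ℕ → I} {B : List (Fin k → Term I)} : instBag δ B = 0 ↔ B = [] := by
  simp [instBag]

variable [LinearOrder I]

theorem carrier_instDatabase_card_le {δ : ℕ → I} {K : List (Term I)}
    {S : List (ℕ × List (Term I))} (hS : ∀ a ∈ S, ∀ t ∈ a.2, t ∈ K) :
    (instDatabase δ S).carrier.card ≤ K.length := by
  have : (instDatabase δ S).carrier ⊆ (K.map (Term.eval δ)).toFinset := fun x hx => by
    obtain ⟨t, ht, rfl⟩ := mem_of_value_mem_carrier hS hx
    simpa using ⟨t, ht, rfl⟩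
  simpa using (Finset.card_le_card this).trans (List.toFinset_card_le _)

variable [Nonempty I]

/-- This allows atoms whose predicate and arity do not occur in the queries to be discarded, so that
a finite pool of symbolic atoms suffices. -/
theorem Query.bag_congr {q : Query I k} {D D' : Database I}
    (h : ∀ a ∈ q.atoms, ∀ γ, a.Holds D γ ↔ a.Holds D' γ) (d : List I) :
    q.bag D d = q.bag D' d := by
  have hsat : ∀ A ∈ q.body, A.satisfying D = A.satisfying D' := by
    intro A hA
    have hmem {a : Atom I} (ha : a ∈ A.pos ++ A.neg) : a ∈ q.atoms :=
      List.mem_flatMap.2 ⟨A, hA, ha⟩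
    ext γ
    refine and_congr_right fun _ => and_congr (forall₂_congr fun a ha => h a (hmem ?_) γ)
      (and_congr_left fun _ => forall₂_congr fun a ha => not_congr (h a (hmem ?_) γ))
    · exact List.mem_append_left _ ha
    · exact List.mem_append_right _ ha
  rw [Query.bag, Query.bag, List.map_congr_left]
  intro A hA
  rw [hsat A hA]

theorem Query.WellFormed.group_value_mem {q : Query I k} (hq : q.WellFormed) {D : Database I}
    {d : List I} (h : q.bag D d ≠ 0) :
    d.length = q.group.length ∧ ∀ x ∈ d, x ∈ D.carrier ∨ x ∈ q.consts := by
  rw [Ne, hq.bag_eq_zero_iff] at h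
  push Not at h
  obtain ⟨A, hA, γ, hγ, rfl⟩ := h
  refine ⟨List.length_map _, fun x hx => ?_⟩
  obtain ⟨v, hv, rfl⟩ := List.mem_map.1 hx
  exact ((hq A hA).1.value_mem hγ ((hq A hA).2.1 v hv)).imp_right fun h =>
    Query.mem_consts.2 ⟨A, hA, h⟩

/-- Any `δ` satisfying the chain turns the symbolic data into a database with at most `N` carrier
elements, to which the hypothesis applies. Validity uses all such `δ`; for the agreement on
emptiness a single one is enough, and it exists because the chain is a complete ordering. -/
theorem symEquivalent_of_nEquivalent {α : Multiset (Fin k → I) → V} {N : ℕ} {q q' : Query I k}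
    (hq : q.WellFormed) (hq' : q'.WellFormed) (h : NEquivalent α N q q') :
    SymEquivalent (fun e => e.IsOrdered ∧ e.Valid α) N q q' := by
  rw [nEquivalent_iff hq hq'] at h
  intro E hE hC hP K hK S hS g hg
  rw [mem_wordsLE] at hE hK hS hg
  have h0 : Term.var 0 ∉ E := fun h => var_zero_notMem_alphabet _ _ (hE.2 _ h)
  have hSK : ∀ a ∈ S, ∀ t ∈ a.2, t ∈ K := fun a ha => (mem_atomPool.1 (hS.2 a ha)).2
  have hSE : ∀ a ∈ S, ∀ t ∈ a.2, t ∈ E := fun a ha t ht => hK.2 t (hSK a ha t ht)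
  have hCq : ∀ A ∈ q.body, ∀ c, Term.const c ∈ A.terms → Term.const c ∈ E := fun A hA c hc =>
    hC c (List.mem_append_left _ (Query.mem_consts.2 ⟨A, hA, hc⟩))
  have hCq' : ∀ A ∈ q'.body, ∀ c, Term.const c ∈ A.terms → Term.const c ∈ E := fun A hA c hc =>
    hC c (List.mem_append_right _ (Query.mem_consts.2 ⟨A, hA, hc⟩))
  have key (δ : ℕ → I) (hδ : (E.map (Term.eval δ)).Pairwise (· < ·)) :
      BagAgree α (instBag δ (q.symBag E S g)) (instBag δ (q'.symBag E S g)) := by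
    rw [← Query.bag_instDatabase hq hδ h0 hSE hg.2 hCq,
      ← Query.bag_instDatabase hq' hδ h0 hSE hg.2 hCq']
    exact h _ ((carrier_instDatabase_card_le hSK).trans hK.1) _
  have hco : IsCompleteOrdering (chain E) E := hP.1.1
  obtain ⟨δ₀, hδ₀⟩ := isCompleteOrdering_chain.1 hco
  refine ⟨?_, fun hne => ⟨⟨hco, fun s => Query.symBag_mem hq, fun s => Query.symBag_mem hq'⟩,
    fun δ hδ => (key δ (chain_holds.1 hδ)).2 (mt instBag_eq_zero.1 hne)⟩⟩
  simpa only [instBag_eq_zero] using (key δ₀ hδ₀).1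

-- Every database and every group with a nonempty bag must be exhibited as an instance of the
-- symbolic data enumerated in `SymEquivalent`. Constants of the queries name themselves, and the
-- remaining carrier elements are named by variables.
open scoped Classical in
theorem nEquivalent_of_symEquivalent {α : Multiset (Fin k → I) → V} {N : ℕ} {q q' : Query I k}
    (hq : q.WellFormed) (hq' : q'.WellFormed)
    (h : SymEquivalent (fun e => e.IsOrdered ∧ e.Valid α) N q q') : NEquivalent α N q q' := by
  rw [nEquivalent_iff hq hq']
  intro D₀ hD₀ d
  -- Only atoms matching the predicate and arity of some query atom are kept; neither bag changes.
  set D : Database I := D₀.filter fun a =>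
    ∃ b ∈ q.atoms ++ q'.atoms, b.pred = a.1 ∧ b.args.length = a.2.length with hD
  have hholds {b : Atom I} (hb : b ∈ q.atoms ++ q'.atoms) (γ : ℕ → I) :
      b.Holds D₀ γ ↔ b.Holds D γ := by
    simp only [Atom.Holds, hD, Finset.mem_filter, List.length_map]
    exact ⟨fun h => ⟨h, b, hb, rfl, rfl⟩, fun h => h.1⟩
  rw [Query.bag_congr (fun a ha => hholds (List.mem_append_left _ ha)) d,
    Query.bag_congr (q := q') (fun a ha => hholds (List.mem_append_right _ ha)) d]
  have hcard : D.carrier.card ≤ N := (Finset.card_le_card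
    (Finset.biUnion_subset_biUnion_of_subset_left _ (Finset.filter_subset _ _))).trans hD₀
  -- If both bags are empty there is nothing to compare. Otherwise `d` has the length of a group of
  -- one of the queries and its entries lie in the carrier or among the constants.
  by_cases h00 : q.bag D d = 0 ∧ q'.bag D d = 0
  · exact ⟨by simp [h00], fun h => (h h00.1).elim⟩
  set C := q.consts ++ q'.consts with hC
  have hd : d.length ≤ q.group.length + q'.group.length ∧ ∀ x ∈ d, x ∈ D.carrier ∨ x ∈ C := by
    rcases not_and_or.1 h00 with h | h
    · obtain ⟨h₁, h₂⟩ := hq.group_value_mem h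
      exact ⟨by omega, fun x hx => (h₂ x hx).imp_right (List.mem_append_left _)⟩
    · obtain ⟨h₁, h₂⟩ := hq'.group_value_mem h
      exact ⟨by omega, fun x hx => (h₂ x hx).imp_right (List.mem_append_right _)⟩
  let Y : List I := (D.carrier \ C.toFinset).toList
  -- `τ` names elements by terms and `δ` undoes the naming; the shift by one matches `alphabet`.
  let δ : ℕ → I := fun v => Y.getD (v - 1) (Classical.arbitrary I)
  let τ : I → Term I := fun x => if x ∈ C then .const x else .var (Y.idxOf x + 1)
  let X : Finset I := D.carrier ∪ C.toFinset
  have hY {x : I} (hx : x ∈ X) (hxC : x ∉ C) : x ∈ Y := by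
    simp only [X, Y, Finset.mem_union, List.mem_toFinset, Finset.mem_toList,
      Finset.mem_sdiff] at hx ⊢
    tauto
  have hτ {x : I} (hx : x ∈ X) : (τ x).eval δ = x := by
    by_cases hxC : x ∈ C
    · simp [τ, hxC, Term.eval]
    · have := List.idxOf_lt_length_of_mem (hY hx hxC)
      simp [τ, hxC, Term.eval, δ, this]
  have hYlen : Y.length ≤ N := by
    simpa [Y] using (Finset.card_le_card Finset.sdiff_subset).trans hcard
  have hmap {l : List I} (hl : ∀ x ∈ l, x ∈ X) : (l.map τ).map (Term.eval δ) = l := by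
    rw [List.map_map]
    exact (List.map_congr_left (g := id) fun x hx => hτ (hl x hx)).trans (List.map_id _)
  let E : List (Term I) := X.sort.map τ
  have hEmap : E.map (Term.eval δ) = X.sort := hmap fun x hx => by simpa using hx
  have hE : (E.map (Term.eval δ)).Pairwise (· < ·) := by
    rw [hEmap]
    exact (Finset.sortedLT_sort X).pairwise
  have hτE {x : I} (hx : x ∈ X) : τ x ∈ E := List.mem_map_of_mem (by simpa using hx)
  have hEalph : ∀ t ∈ E, t ∈ alphabet N C := by
    intro t ht
    obtain ⟨x, hx, rfl⟩ := List.mem_map.1 ht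
    rw [Finset.mem_sort] at hx
    by_cases hxC : x ∈ C
    · simp [τ, hxC, alphabet]
    · have := List.idxOf_lt_length_of_mem (hY hx hxC)
      simp only [τ, hxC, if_false, alphabet, List.mem_append, List.mem_map, List.mem_range]
      exact Or.inl ⟨_, this.trans_le hYlen, rfl⟩
  have hElen : E.length ≤ N + C.length := by
    simp only [E, List.length_map, Finset.length_sort]
    exact (Finset.card_union_le _ _).trans (add_le_add hcard (List.toFinset_card_le _))
  have hCE : ∀ c ∈ C, Term.const c ∈ E := fun c hc => by
    have := hτE (x := c) (by simp [X, hc])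
    simpa [τ, hc] using this
  have hco : IsCompleteOrdering (chain E) E := isCompleteOrdering_chain.2 ⟨δ, hE⟩
  let K : List (Term I) := D.carrier.toList.map τ
  have hcarX {x : I} (hx : x ∈ D.carrier) : x ∈ X := Finset.mem_union_left _ hx
  have hmemK {x : I} (hx : x ∈ D.carrier) : τ x ∈ K := List.mem_map_of_mem (by simpa using hx)
  have hKE : ∀ t ∈ K, t ∈ E := by
    intro t ht
    obtain ⟨x, hx, rfl⟩ := List.mem_map.1 ht
    exact hτE (hcarX (by simpa using hx))
  let S : List (ℕ × List (Term I)) := D.toList.map fun a => (a.1, a.2.map τ)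
  have hDcar {a : ℕ × List I} (ha : a ∈ D) : ∀ x ∈ a.2, x ∈ D.carrier := fun x hx =>
    Finset.mem_biUnion.2 ⟨a, ha, by simpa using hx⟩
  have hSmap : (S.map fun a => (a.1, a.2.map (Term.eval δ))) = D.toList := by
    rw [List.map_map]
    refine (List.map_congr_left (g := id) fun a ha => ?_).trans (List.map_id _)
    exact Prod.ext rfl (hmap fun x hx => hcarX (hDcar (by simpa using ha) x hx))
  have hinst : instDatabase δ S = D := by
    rw [instDatabase, hSmap, Finset.toList_toFinset]
  have hSpool : ∀ b ∈ S, b ∈ atomPool K (q.atoms ++ q'.atoms) := by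
    intro b hb
    obtain ⟨a, ha, rfl⟩ := List.mem_map.1 hb
    rw [Finset.mem_toList] at ha
    refine mem_atomPool.2 ⟨?_, fun t ht => ?_⟩
    · simpa using (Finset.mem_filter.1 ha).2
    · obtain ⟨x, hx, rfl⟩ := List.mem_map.1 ht
      exact hmemK (hDcar ha x hx)
  -- Instantiating `S` gives back the duplicate-free list of atoms of `D`. So `S` has no duplicates
  -- either and fits into the pool.
  have hSlen : S.length ≤ (atomPool K (q.atoms ++ q'.atoms)).length := by
    refine List.Subperm.length_le (List.Nodup.subperm (List.Nodup.of_map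
      (fun a => (a.1, a.2.map (Term.eval δ))) ?_) hSpool)
    rw [hSmap]
    exact D.nodup_toList
  have hdX : ∀ x ∈ d, x ∈ X := fun x hx => by
    simpa [X] using hd.2 x hx
  have hgE : ∀ t ∈ d.map τ, t ∈ E := fun t ht => by
    obtain ⟨x, hx, rfl⟩ := List.mem_map.1 ht
    exact hτE (hdX x hx)
  have hSE : ∀ a ∈ S, ∀ t ∈ a.2, t ∈ E := fun a ha t ht =>
    hKE t ((mem_atomPool.1 (hSpool a ha)).2 t ht)
  have h0 : Term.var 0 ∉ E := fun h => var_zero_notMem_alphabet _ _ (hEalph _ h)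
  have hbag : q.bag D d = instBag δ (q.symBag E S (d.map τ)) := by
    have := Query.bag_instDatabase hq hE h0 hSE hgE fun A hA c hc =>
      hCE c (List.mem_append_left _ (Query.mem_consts.2 ⟨A, hA, hc⟩))
    rwa [hinst, hmap hdX] at this
  have hbag' : q'.bag D d = instBag δ (q'.symBag E S (d.map τ)) := by
    have := Query.bag_instDatabase hq' hE h0 hSE hgE fun A hA c hc =>
      hCE c (List.mem_append_right _ (Query.mem_consts.2 ⟨A, hA, hc⟩))
    rwa [hinst, hmap hdX] at this
  obtain ⟨h₁, h₂⟩ := h E (mem_wordsLE.2 ⟨hElen, hEalph⟩) hCE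
    ⟨⟨hco, by simp, by simp⟩, fun _ _ => rfl⟩
    K (mem_wordsLE.2 ⟨by simpa [K] using hcard, hKE⟩) S (mem_wordsLE.2 ⟨hSlen, hSpool⟩)
    (d.map τ) (mem_wordsLE.2 ⟨by simpa using hd.1, hgE⟩)
  rw [hbag, hbag']
  refine ⟨by rw [instBag_eq_zero, instBag_eq_zero, h₁], fun hne => ?_⟩
  exact (h₂ (mt instBag_eq_zero.2 hne)).2 δ (chain_holds.2 hE)

end Decision

end AggQuery

namespace AggQuery

/-! ### Symbolic evaluation is primitive recursive. -/

section SymbolicPrimrec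

variable {I : Type*} [Primcodable I] {k : ℕ} {σ : Type*} [Primcodable σ]

theorem primrec_getD {w : σ → List (Term I)} {v : σ → ℕ} (hw : Primrec w) (hv : Primrec v) :
    Primrec fun a => (w a).getD (v a) (.var 0) :=
  (Primrec.list_getD (Term.var 0)).comp hw hv

theorem Term.primrec_subst : Primrec₂ (Term.subst (I := I)) :=
  (Term.primrec_cases (f := fun (p : List (Term I) × Term I) v => p.1.getD v (.var 0))
    (g := fun _ c => .const c) Primrec.snd
    (primrec_getD (Primrec.fst.comp Primrec.fst) Primrec.snd)
    (Term.primrec_const.comp Primrec.snd)).of_eq fun p => by cases h : p.2 <;> rfl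

theorem primrec_substAtom : Primrec₂ fun (w : List (Term I)) (a : Atom I) =>
    (a.pred, a.args.map (Term.subst w)) :=
  (Atom.primrec_pred.comp Primrec.snd).pair
    (Primrec.list_map (Atom.primrec_args.comp Primrec.snd)
      (Term.primrec_subst.comp (Primrec.fst.comp Primrec.fst) Primrec.snd))

theorem CmpOp.primrecPred_holds {o : σ → CmpOp} {m n : σ → ℕ} (ho : Primrec o) (hm : Primrec m)
    (hn : Primrec n) : PrimrecPred fun a => (o a).Holds (m a) (n a) := by
  have hop (c : CmpOp) : PrimrecPred fun a => o a = c := Primrec.eq.comp ho (Primrec.const c)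
  have hlt := Primrec.nat_lt.comp hm hn
  have hgt := Primrec.nat_lt.comp hn hm
  have heq := Primrec.eq.comp hm hn
  refine (((((((hop .lt).and hlt).or ((hop .le).and hgt.not)).or ((hop .eq).and heq)).or
    ((hop .ne).and heq.not)).or ((hop .ge).and hlt.not)).or ((hop .gt).and hgt)).of_eq fun a => ?_
  cases o a <;> simp [CmpOp.Holds]

open scoped Classical in
theorem Condition.primrecPred_symHolds {A : σ → Condition I} {S : σ → List (ℕ × List (Term I))}
    {E w : σ → List (Term I)} (hA : Primrec A) (hS : Primrec S) (hE : Primrec E)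
    (hw : Primrec w) : PrimrecPred fun a => (A a).SymHolds (S a) (E a) (w a) := by
  have hmem : PrimrecRel fun (a : σ) (b : Atom I) =>
      (b.pred, b.args.map (Term.subst (w a))) ∈ S a :=
    PrimrecPred.mem_list (primrec_substAtom.comp (hw.comp Primrec.fst) Primrec.snd)
      (hS.comp Primrec.fst)
  have hidx {t : Comparison I → Term I} (ht : Primrec t) :
      Primrec fun p : σ × Comparison I => (E p.1).idxOf ((t p.2).subst (w p.1)) :=
    Primrec.list_idxOf.comp
      (Term.primrec_subst.comp (hw.comp Primrec.fst) (ht.comp Primrec.snd))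
      (hE.comp Primrec.fst)
  have hcmp : PrimrecRel fun (a : σ) (c : Comparison I) =>
      c.op.Holds ((E a).idxOf (c.lhs.subst (w a))) ((E a).idxOf (c.rhs.subst (w a))) :=
    CmpOp.primrecPred_holds (Comparison.primrec_op.comp Primrec.snd)
      (hidx Comparison.primrec_lhs) (hidx Comparison.primrec_rhs)
  exact (PrimrecPred.forall_mem (Condition.primrec_pos.comp hA) hmem).and
    ((PrimrecPred.forall_mem (Condition.primrec_neg.comp hA) hmem.not).and
      (PrimrecPred.forall_mem (Condition.primrec_cmp.comp hA) hcmp))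

theorem Condition.primrecPred_symSatisfies {A : σ → Condition I}
    {S : σ → List (ℕ × List (Term I))} {E w : σ → List (Term I)} (hA : Primrec A)
    (hS : Primrec S) (hE : Primrec E) (hw : Primrec w) :
    PrimrecPred fun a => (A a).SymSatisfies (S a) (E a) (w a) := by
  have hv : PrimrecRel fun (a : σ) (v : ℕ) => v ∈ (A a).vars :=
    PrimrecPred.mem_list Primrec.snd (Condition.primrec_vars.comp (hA.comp Primrec.fst))
  have hval : Primrec fun p : σ × ℕ => (w p.1).getD p.2 (.var 0) :=
    primrec_getD (hw.comp Primrec.fst) Primrec.snd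
  have hin : PrimrecRel fun (a : σ) (v : ℕ) => (w a).getD v (.var 0) ∈ E a :=
    PrimrecPred.mem_list hval (hE.comp Primrec.fst)
  have hout : PrimrecRel fun (a : σ) (v : ℕ) => (w a).getD v (.var 0) = .var 0 :=
    Primrec.eq.comp hval (Primrec.const _)
  exact (PrimrecPred.forall_mem
    (R := fun a v => (v ∈ (A a).vars → (w a).getD v (.var 0) ∈ E a) ∧
      (v ∉ (A a).vars → (w a).getD v (.var 0) = .var 0))
    (Primrec.list_range.comp (primrec_strictBound.comp (Condition.primrec_vars.comp hA)))
    (PrimrecPred.and (PrimrecPred.imp hv hin) (PrimrecPred.imp hv.not hout))).and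
    (Condition.primrecPred_symHolds hA hS hE hw)

theorem Condition.primrec_symAssignments {A : σ → Condition I}
    {S : σ → List (ℕ × List (Term I))} {E g : σ → List (Term I)} {x : σ → List ℕ}
    (hA : Primrec A) (hS : Primrec S) (hE : Primrec E) (hx : Primrec x) (hg : Primrec g) :
    Primrec fun a => (A a).symAssignments (S a) (E a) (x a) (g a) := by
  classical
  refine Primrec.list_filter
    (R := fun a w => (A a).SymSatisfies (S a) (E a) w ∧
      ((x a).map fun v => w.getD v (.var 0)) = g a)
    (primrec_words.comp (Primrec.list_cons.comp (Primrec.const _) hE)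
      (primrec_strictBound.comp (Condition.primrec_vars.comp hA)))
    (PrimrecPred.and (Condition.primrecPred_symSatisfies (hA.comp Primrec.fst)
      (hS.comp Primrec.fst) (hE.comp Primrec.fst) Primrec.snd) ?_)
  exact Primrec.eq.comp (Primrec.list_map (hx.comp Primrec.fst)
    (primrec_getD (Primrec.snd.comp Primrec.fst) Primrec.snd)) (hg.comp Primrec.fst)

theorem Query.primrec_symBag {q : σ → Query I k} {S : σ → List (ℕ × List (Term I))}
    {E g : σ → List (Term I)} (hq : Primrec q) (hE : Primrec E) (hS : Primrec S)
    (hg : Primrec g) : Primrec fun a => (q a).symBag (E a) (S a) (g a) := by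
  refine Primrec.list_flatMap (Query.primrec_body.comp hq) (Primrec.list_map
    (Condition.primrec_symAssignments Primrec.snd (hS.comp Primrec.fst) (hE.comp Primrec.fst)
      (Query.primrec_group.comp (hq.comp Primrec.fst)) (hg.comp Primrec.fst))
    (primrec_tuple fun i => primrec_getD Primrec.snd ?_))
  exact primrec_apply (Query.primrec_agg.comp (hq.comp (Primrec.fst.comp Primrec.fst))) i

theorem primrec_chain : Primrec (chain (I := I)) := by
  refine Primrec.list_flatMap (Primrec.list_range.comp Primrec.list_length)
    (Primrec.list_map (Primrec.list_range.comp Primrec.snd) ?_)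
  exact Comparison.primrec_mk
    (primrec_getD (Primrec.fst.comp Primrec.fst) Primrec.snd) (Primrec.const _)
    (primrec_getD (Primrec.fst.comp Primrec.fst) (Primrec.snd.comp Primrec.fst))

theorem Term.primrec_consts : Primrec (Term.consts (I := I)) :=
  (Term.primrec_cases (f := fun _ _ => []) (g := fun _ c => [c]) Primrec.id (Primrec.const [])
    (Primrec.list_cons.comp Primrec.snd (Primrec.const []))).of_eq fun t => by cases t <;> rfl

theorem Query.primrec_consts : Primrec (Query.consts (I := I) (k := k)) :=
  Primrec.list_flatMap Query.primrec_body
    (Primrec.list_flatMap (Condition.primrec_terms.comp Primrec.snd)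
      (Term.primrec_consts.comp₂ Primrec₂.right))

theorem Query.primrec_atoms : Primrec (Query.atoms (I := I) (k := k)) :=
  Primrec.list_flatMap Query.primrec_body
    (Primrec.list_append.comp (Condition.primrec_pos.comp Primrec.snd)
      (Condition.primrec_neg.comp Primrec.snd))

theorem primrec_alphabet : Primrec₂ (alphabet (I := I)) :=
  Primrec.list_append.comp
    (Primrec.list_map (Primrec.list_range.comp Primrec.fst)
      (Term.primrec_var.comp (Primrec.succ.comp Primrec.snd)))
    (Primrec.list_map Primrec.snd (Term.primrec_const.comp₂ Primrec₂.right))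

theorem primrec_atomPool : Primrec₂ (atomPool (I := I)) := by
  refine Primrec.list_flatMap Primrec.snd (Primrec.list_map
    (primrec_words.comp (Primrec.fst.comp Primrec.fst)
      (Primrec.list_length.comp (Atom.primrec_args.comp Primrec.snd))) ?_)
  exact (Atom.primrec_pred.comp (Primrec.snd.comp Primrec.fst)).pair Primrec.snd

end SymbolicPrimrec

/-! ### Deciding safety and well-formedness. -/

section WellFormed

variable {I : Type*} {k : ℕ}

/-- The list `s` of variables contains the variables of `A` that are limited by a relational atom or
a constant, and is closed under the equalities of `A`. -/
def Condition.LimitClosed (A : Condition I) (s : List ℕ) : Prop :=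
  (∀ a ∈ A.pos, ∀ t ∈ a.args, ∀ v ∈ t.vars, v ∈ s) ∧
  (∀ c ∈ A.cmp, c.op = .eq → (c.lhs.vars = [] → ∀ v ∈ c.rhs.vars, v ∈ s) ∧
    (c.rhs.vars = [] → ∀ v ∈ c.lhs.vars, v ∈ s) ∧
    ∀ v ∈ c.lhs.vars, ∀ w ∈ c.rhs.vars, (v ∈ s ↔ w ∈ s))

theorem Condition.LimitClosed.mem {A : Condition I} {s : List ℕ} (hs : A.LimitClosed s) {v : ℕ}
    (hv : A.Limited v) : v ∈ s := by
  induction hv with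
  | pos ha hv => exact hs.1 _ ha _ hv _ (by simp [Term.vars])
  | const h =>
    rcases h with h | h
    · exact (hs.2 _ h rfl).2.1 rfl _ (by simp [Term.vars])
    · exact (hs.2 _ h rfl).1 rfl _ (by simp [Term.vars])
  | eq hw h ih =>
    rcases h with h | h
    · exact ((hs.2 _ h rfl).2.2 _ (by simp [Term.vars]) _ (by simp [Term.vars])).2 ih
    · exact ((hs.2 _ h rfl).2.2 _ (by simp [Term.vars]) _ (by simp [Term.vars])).1 ih

open scoped Classical in
theorem Condition.limitClosed_limited (A : Condition I) :
    A.LimitClosed (A.vars.filter fun v => A.Limited v) := by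
  have hvar {t : Term I} {v : ℕ} : v ∈ t.vars ↔ t = .var v := by
    cases t <;> simp [Term.vars, eq_comm]
  have hnil {t : Term I} : t.vars = [] ↔ ∃ c, t = .const c := by
    cases t <;> simp [Term.vars]
  simp only [LimitClosed, hvar, hnil, List.mem_filter, decide_eq_true_eq]
  refine ⟨?_, ?_⟩
  · rintro a ha t ht v rfl
    exact ⟨mem_vars.2 (mem_terms_of_mem_pos ha ht), .pos ha ht⟩
  · rintro ⟨s, o, t⟩ hc rfl
    obtain ⟨h₁, h₂⟩ := mem_terms_of_mem_cmp hc
    dsimp only at h₁ h₂ ⊢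
    refine ⟨?_, ?_, ?_⟩
    · rintro ⟨c, rfl⟩ v rfl
      exact ⟨mem_vars.2 h₂, .const (Or.inr hc)⟩
    · rintro ⟨c, rfl⟩ v rfl
      exact ⟨mem_vars.2 h₁, .const (Or.inl hc)⟩
    · rintro v rfl w rfl
      exact ⟨fun h => ⟨mem_vars.2 h₂, .eq h.2 (Or.inr hc)⟩,
        fun h => ⟨mem_vars.2 h₁, .eq h.2 (Or.inl hc)⟩⟩

/-- The limited variables form the least set closed under the rules for `Limited`. Quantifying over
all closed lists drawn from `A.vars` replaces the inductive definition by a bounded search. -/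
theorem Condition.safe_iff (A : Condition I) :
    A.Safe ↔ ∀ s ∈ wordsLE A.vars A.vars.length, A.LimitClosed s → ∀ v ∈ A.vars, v ∈ s := by
  classical
  refine ⟨fun h s _ hs v hv => hs.mem (h v hv), fun h v hv => ?_⟩
  have := h _ (mem_wordsLE.2 ⟨List.length_filter_le _ _, fun a ha => (List.mem_filter.1 ha).1⟩)
    A.limitClosed_limited v hv
  simpa using (List.mem_filter.1 this).2

variable [Primcodable I]

theorem Condition.primrecRel_limitClosed : PrimrecRel (Condition.LimitClosed (I := I)) := by
  have h₁ : PrimrecPred fun p : Condition I × List ℕ =>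
      ∀ a ∈ p.1.pos, ∀ t ∈ a.args, ∀ v ∈ t.vars, v ∈ p.2 := by
    refine PrimrecPred.forall_mem (Condition.primrec_pos.comp Primrec.fst)
      (PrimrecPred.forall_mem (Atom.primrec_args.comp Primrec.snd)
        (PrimrecPred.forall_mem (Term.primrec_vars.comp Primrec.snd)
          (PrimrecPred.mem_list Primrec.snd ?_)))
    exact Primrec.snd.comp (Primrec.fst.comp (Primrec.fst.comp Primrec.fst))
  have hl : Primrec fun p : (Condition I × List ℕ) × Comparison I => p.2.lhs.vars :=
    Term.primrec_vars.comp (Comparison.primrec_lhs.comp Primrec.snd)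
  have hr : Primrec fun p : (Condition I × List ℕ) × Comparison I => p.2.rhs.vars :=
    Term.primrec_vars.comp (Comparison.primrec_rhs.comp Primrec.snd)
  have hs : Primrec fun p : (Condition I × List ℕ) × Comparison I => p.1.2 :=
    Primrec.snd.comp Primrec.fst
  have hm : PrimrecRel fun (p : (Condition I × List ℕ) × Comparison I) (v : ℕ) => v ∈ p.1.2 :=
    PrimrecPred.mem_list Primrec.snd (hs.comp Primrec.fst)
  have h₂ : PrimrecRel fun (p : Condition I × List ℕ) (c : Comparison I) =>
      c.op = .eq → (c.lhs.vars = [] → ∀ v ∈ c.rhs.vars, v ∈ p.2) ∧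
      (c.rhs.vars = [] → ∀ v ∈ c.lhs.vars, v ∈ p.2) ∧
      ∀ v ∈ c.lhs.vars, ∀ w ∈ c.rhs.vars, (v ∈ p.2 ↔ w ∈ p.2) := by
    refine PrimrecPred.imp
      (Primrec.eq.comp (Comparison.primrec_op.comp Primrec.snd) (Primrec.const _))
      (((Primrec.eq.comp hl (Primrec.const [])).imp (PrimrecPred.forall_mem hr hm)).and
      (((Primrec.eq.comp hr (Primrec.const [])).imp (PrimrecPred.forall_mem hl hm)).and ?_))
    refine PrimrecPred.forall_mem hl (PrimrecPred.forall_mem (hr.comp Primrec.fst) ?_)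
    exact PrimrecPred.iff (hm.comp (Primrec.fst.comp Primrec.fst) (Primrec.snd.comp Primrec.fst))
      (hm.comp (Primrec.fst.comp Primrec.fst) Primrec.snd)
  exact PrimrecPred.and h₁ (PrimrecPred.forall_mem (Condition.primrec_cmp.comp Primrec.fst) h₂)

theorem Condition.primrecPred_safe : PrimrecPred (Condition.Safe (I := I)) := by
  refine PrimrecPred.of_eq ?_ fun A => A.safe_iff.symm
  refine PrimrecPred.forall_mem
    (primrec_wordsLE.comp Condition.primrec_vars
      (Primrec.list_length.comp Condition.primrec_vars))
    (PrimrecPred.imp Condition.primrecRel_limitClosed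
      (PrimrecPred.forall_mem (Condition.primrec_vars.comp Primrec.fst) ?_))
  exact PrimrecPred.mem_list Primrec.snd (Primrec.snd.comp Primrec.fst)

theorem Query.primrecPred_wellFormed : PrimrecPred (Query.WellFormed (I := I) (k := k)) := by
  have hvars : Primrec fun p : (Query I k × Condition I) × ℕ => p.1.2.vars :=
    Condition.primrec_vars.comp (Primrec.snd.comp Primrec.fst)
  have hagg : PrimrecRel fun (q : Query I k) (A : Condition I) => ∀ i, q.agg i ∈ A.vars := by
    have : PrimrecRel fun (q : Query I k) (A : Condition I) =>
        ∀ v ∈ List.ofFn q.agg, v ∈ A.vars :=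
      PrimrecPred.forall_mem (Primrec.list_ofFn fun i =>
        primrec_apply (Query.primrec_agg.comp Primrec.fst) i)
        (PrimrecPred.mem_list Primrec.snd hvars)
    exact this.of_eq fun q A => by simp [List.mem_ofFn]
  exact PrimrecPred.forall_mem Query.primrec_body
    (PrimrecPred.and (Condition.primrecPred_safe.comp Primrec.snd)
      (PrimrecPred.and (PrimrecPred.forall_mem (Query.primrec_group.comp Primrec.fst)
        (PrimrecPred.mem_list Primrec.snd hvars)) hagg))

end WellFormed

/-! ### Order-decidability implies decidability of bounded equivalence. -/

section Main

variable {I : Type*} [Primcodable I] {k : ℕ}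

/-- All quantifiers range over primitive recursively computed lists, and `P` is asked only about
identities computed from their elements. -/
theorem computablePred_symEquivalent {P : Identity I k → Prop} (hP : ComputablePred P) :
    ComputablePred fun x : ℕ × Query I k × Query I k => SymEquivalent P x.1 x.2.1 x.2.2 := by
  let X := ℕ × Query I k × Query I k
  have hN : Primrec fun x : X => x.1 := Primrec.fst
  have hq : Primrec fun x : X => x.2.1 := Primrec.fst.comp Primrec.snd
  have hq' : Primrec fun x : X => x.2.2 := Primrec.snd.comp Primrec.snd
  have hC : Primrec fun x : X => x.2.1.consts ++ x.2.2.consts :=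
    Primrec.list_append.comp (Query.primrec_consts.comp hq) (Query.primrec_consts.comp hq')
  have hEs : Primrec fun x : X => wordsLE (alphabet x.1 (x.2.1.consts ++ x.2.2.consts))
      (x.1 + (x.2.1.consts ++ x.2.2.consts).length) :=
    primrec_wordsLE.comp (primrec_alphabet.comp hN hC)
      (Primrec.nat_add.comp hN (Primrec.list_length.comp hC))
  refine ComputablePred.forall_mem hEs.to_comp (ComputablePred.imp ?_ (ComputablePred.imp ?_ ?_))
  · refine PrimrecPred.computablePred (PrimrecPred.forall_mem (hC.comp Primrec.fst) ?_)
    exact PrimrecPred.mem_list (Term.primrec_const.comp Primrec.snd)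
      (Primrec.snd.comp Primrec.fst)
  · exact hP.comp (Identity.primrec_mk Primrec.snd (primrec_chain.comp Primrec.snd)
      (Primrec.const []) (Primrec.const [])).to_comp
  have hKs : Primrec fun p : X × List (Term I) => wordsLE p.2 p.1.1 :=
    primrec_wordsLE.comp Primrec.snd (hN.comp Primrec.fst)
  refine ComputablePred.forall_mem hKs.to_comp ?_
  have hpool : Primrec fun p : (X × List (Term I)) × List (Term I) =>
      atomPool p.2 (p.1.1.2.1.atoms ++ p.1.1.2.2.atoms) :=
    primrec_atomPool.comp Primrec.snd (Primrec.list_append.comp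
      (Query.primrec_atoms.comp (hq.comp (Primrec.fst.comp Primrec.fst)))
      (Query.primrec_atoms.comp (hq'.comp (Primrec.fst.comp Primrec.fst))))
  refine ComputablePred.forall_mem
    (primrec_wordsLE.comp hpool (Primrec.list_length.comp hpool)).to_comp ?_
  have hE : Primrec fun p : ((X × List (Term I)) × List (Term I)) × List (ℕ × List (Term I)) =>
      p.1.1.2 := Primrec.snd.comp (Primrec.fst.comp Primrec.fst)
  have hx : Primrec fun p : ((X × List (Term I)) × List (Term I)) × List (ℕ × List (Term I)) =>
      p.1.1.1 := Primrec.fst.comp (Primrec.fst.comp Primrec.fst)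
  have hgs : Primrec fun p : ((X × List (Term I)) × List (Term I)) × List (ℕ × List (Term I)) =>
      wordsLE p.1.1.2 (p.1.1.1.2.1.group.length + p.1.1.1.2.2.group.length) :=
    primrec_wordsLE.comp hE (Primrec.nat_add.comp
      (Primrec.list_length.comp (Query.primrec_group.comp (hq.comp hx)))
      (Primrec.list_length.comp (Query.primrec_group.comp (hq'.comp hx))))
  refine ComputablePred.forall_mem hgs.to_comp ?_
  let Z := (((X × List (Term I)) × List (Term I)) × List (ℕ × List (Term I))) × List (Term I)
  have hB : Primrec fun p : Z => p.1.1.1.1.2.1.symBag p.1.1.1.2 p.1.2 p.2 :=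
    Query.primrec_symBag (hq.comp (hx.comp Primrec.fst)) (hE.comp Primrec.fst)
      (Primrec.snd.comp Primrec.fst) Primrec.snd
  have hB' : Primrec fun p : Z => p.1.1.1.1.2.2.symBag p.1.1.1.2 p.1.2 p.2 :=
    Query.primrec_symBag (hq'.comp (hx.comp Primrec.fst)) (hE.comp Primrec.fst)
      (Primrec.snd.comp Primrec.fst) Primrec.snd
  have hnil : PrimrecPred fun p : Z => p.1.1.1.1.2.1.symBag p.1.1.1.2 p.1.2 p.2 = [] :=
    Primrec.eq.comp hB (Primrec.const [])
  have hnil' : PrimrecPred fun p : Z => p.1.1.1.1.2.2.symBag p.1.1.1.2 p.1.2 p.2 = [] :=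
    Primrec.eq.comp hB' (Primrec.const [])
  refine ComputablePred.and (hnil.iff hnil').computablePred
    (ComputablePred.imp hnil.not.computablePred ?_)
  exact hP.comp (Identity.primrec_mk (hE.comp Primrec.fst)
    (primrec_chain.comp (hE.comp Primrec.fst)) hB hB').to_comp

variable [LinearOrder I] [Nonempty I] {V : Type*}

theorem boundedEquivalenceDecidable_of_orderDecidable {α : Multiset (Fin k → I) → V}
    (h : OrderDecidable α) : BoundedEquivalenceDecidable α := by
  have hN : PrimrecPred fun x : ℕ × Query I k × Query I k => 0 < x.1 :=
    Primrec.nat_lt.comp (Primrec.const 0) Primrec.fst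
  have hq : PrimrecPred fun x : ℕ × Query I k × Query I k => x.2.1.WellFormed :=
    Query.primrecPred_wellFormed.comp (Primrec.fst.comp Primrec.snd)
  have hq' : PrimrecPred fun x : ℕ × Query I k × Query I k => x.2.2.WellFormed :=
    Query.primrecPred_wellFormed.comp (Primrec.snd.comp Primrec.snd)
  refine (hN.computablePred.and (hq.computablePred.and (hq'.computablePred.and
    (computablePred_symEquivalent h)))).of_eq fun x => ?_
  refine and_congr_right fun _ => and_congr_right fun hq => and_congr_right fun hq' => ?_
  exact ⟨nEquivalent_of_symEquivalent hq hq', symEquivalent_of_nEquivalent hq hq'⟩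

end Main

end AggQuery

namespace AggQuery

/-! ### Encoding an identity by a pair of queries. -/

section IdentityQuery

variable {I : Type*} {k : ℕ}

/-- A disjunct over the variables `0, …, M - 1` which are listed in a relational atom, and over `k`
further variables that are equated with the terms of the tuple `s`. -/
def tupleCondition (M : ℕ) (L : List (Comparison I)) (s : Fin k → Term I) : Condition I :=
  -- The variables `M + i` are needed because the aggregated tuple must consist of variables shared
  -- by all disjuncts, whereas `s i` varies with the disjunct and may be a constant.
  ⟨[⟨0, (List.range M).map .var⟩], [], L ++ List.ofFn fun i => ⟨.var (M + i), .eq, s i⟩⟩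

/-- A query with grouping variables `0, …, M - 1` that collects the bag `B` for every group
satisfying `L`. -/
def identityQuery (M : ℕ) (L : List (Comparison I)) (B : List (Fin k → Term I)) : Query I k :=
  ⟨List.range M, fun i => M + i, B.map (tupleCondition M L)⟩

/-- All variables of the comparisons are smaller than `M`. -/
def ComparisonsBounded (M : ℕ) (L : List (Comparison I)) : Prop :=
  ∀ c ∈ L, (∀ v ∈ c.lhs.vars, v < M) ∧ ∀ v ∈ c.rhs.vars, v < M

theorem mem_tupleCondition_vars {M : ℕ} {L : List (Comparison I)} (hL : ComparisonsBounded M L)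
    {s : Fin k → Term I} (hs : ∀ i, ∀ v ∈ (s i).vars, v < M) {v : ℕ} :
    v ∈ (tupleCondition M L s).vars ↔ v < M ∨ ∃ i : Fin k, v = M + i := by
  simp only [Condition.vars, tupleCondition, List.append_nil, List.flatMap_cons, List.flatMap_nil,
    List.flatMap_append, List.mem_append, List.mem_flatMap, List.mem_map, List.mem_range,
    List.mem_ofFn]
  constructor
  · rintro (⟨_, ⟨u, hu, rfl⟩, hv⟩ | ⟨c, hc, hv | hv⟩ | ⟨_, ⟨i, rfl⟩, hv | hv⟩)
    · simp only [Term.vars, List.mem_singleton] at hv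
      exact Or.inl (hv ▸ hu)
    · exact Or.inl ((hL c hc).1 v hv)
    · exact Or.inl ((hL c hc).2 v hv)
    · simp only [Term.vars, List.mem_singleton] at hv
      exact Or.inr ⟨i, hv⟩
    · exact Or.inl (hs i v hv)
  · rintro (hv | ⟨i, rfl⟩)
    · exact Or.inl ⟨_, ⟨v, hv, rfl⟩, by simp [Term.vars]⟩
    · exact Or.inr (Or.inr ⟨_, ⟨i, rfl⟩, Or.inl (by simp [Term.vars])⟩)

theorem identityQuery_wellFormed {M : ℕ} {L : List (Comparison I)} {B : List (Fin k → Term I)}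
    (hL : ComparisonsBounded M L) (hB : ∀ s ∈ B, ∀ i, ∀ v ∈ (s i).vars, v < M) :
    (identityQuery M L B).WellFormed := by
  intro A hA
  obtain ⟨s, hs, rfl⟩ := List.mem_map.1 hA
  have hvars {v : ℕ} := mem_tupleCondition_vars hL (hB s hs) (v := v)
  refine ⟨fun v hv => ?_, fun v hv => hvars.2 (Or.inl (List.mem_range.1 hv)),
    fun i => hvars.2 (Or.inr ⟨i, rfl⟩)⟩
  have hpos {v : ℕ} (hv : v < M) : (tupleCondition M L s).Limited v :=
    .pos (List.mem_singleton.2 rfl) (by simpa using hv)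
  rcases hvars.1 hv with hv | ⟨i, rfl⟩
  · exact hpos hv
  · have hmem : (⟨.var (M + i), .eq, s i⟩ : Comparison I) ∈ (tupleCondition M L s).cmp :=
      List.mem_append_right _ (List.mem_ofFn.2 ⟨i, rfl⟩)
    cases hsi : s i with
    | var w =>
      rw [hsi] at hmem
      exact .eq (hpos (hB s hs i w (by simp [hsi, Term.vars]))) (Or.inl hmem)
    | const c =>
      rw [hsi] at hmem
      exact .const (Or.inl hmem)

theorem Term.eval_congr {δ δ' : ℕ → I} {t : Term I} (h : ∀ v ∈ t.vars, δ v = δ' v) :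
    t.eval δ = t.eval δ' := by
  cases t with
  | var v => exact h v (by simp [Term.vars])
  | const c => rfl

variable [LinearOrder I]

theorem comparisons_congr {M : ℕ} {L : List (Comparison I)} (hL : ComparisonsBounded M L)
    {δ δ' : ℕ → I} (h : ∀ v < M, δ v = δ' v) : (∀ c ∈ L, c.Holds δ) ↔ ∀ c ∈ L, c.Holds δ' := by
  refine forall₂_congr fun c hc => ?_
  rw [Comparison.Holds, Term.eval_congr fun v hv => h v ((hL c hc).1 v hv),
    Term.eval_congr fun v hv => h v ((hL c hc).2 v hv), Comparison.Holds]

variable [Nonempty I]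

-- The group fixes the variables below `M`, and the equalities then fix the variables `M + i`. Each
-- disjunct therefore has at most one satisfying assignment per group, which gives every tuple of
-- `B` its correct multiplicity.
open scoped Classical in
theorem satisfying_tupleCondition {M : ℕ} {L : List (Comparison I)}
    (hL : ComparisonsBounded M L) {s : Fin k → Term I} (hs : ∀ i, ∀ v ∈ (s i).vars, v < M)
    (D : Database I) (δ : ℕ → I) :
    {γ | γ ∈ (tupleCondition M L s).satisfying D ∧
      (List.range M).map γ = (List.range M).map δ} =
    if (0, (List.range M).map δ) ∈ D ∧ ∀ c ∈ L, c.Holds δ then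
      {fun v => if v < M then δ v else if h : ∃ i : Fin k, v = M + i then
        (s h.choose).eval δ else Classical.arbitrary I} else ∅ := by
  have hvars {v : ℕ} := mem_tupleCondition_vars hL hs (v := v)
  have hmap (γ : ℕ → I) : (List.range M).map γ = (List.range M).map δ ↔ ∀ v < M, γ v = δ v := by
    simp [List.map_inj_left]
  have hsat {γ : ℕ → I} (hγ : ∀ v < M, γ v = δ v) : (tupleCondition M L s).Holds D γ ↔
      ((0, (List.range M).map δ) ∈ D ∧ ∀ c ∈ L, c.Holds δ) ∧
        ∀ i : Fin k, γ (M + i) = (s i).eval δ := by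
    have hγ' : (List.range M).map (Term.eval γ ∘ Term.var) = (List.range M).map δ :=
      (hmap γ).2 hγ
    have hL' := comparisons_congr hL hγ
    simp only [Condition.Holds, tupleCondition, List.mem_singleton, forall_eq, Atom.Holds,
      List.map_map, hγ', List.not_mem_nil, false_imp_iff, implies_true, true_and,
      List.mem_append, or_imp, forall_and, List.mem_ofFn, forall_exists_index,
      forall_apply_eq_imp_iff, hL', and_assoc]
    refine and_congr_right fun _ => and_congr_right fun _ => forall_congr' fun i => ?_
    rw [← Term.eval_congr fun v hv => hγ v (hs i v hv)]
    rfl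
  -- The chosen index is the expected one, since `M + i` determines `i`.
  have hchoose (i : Fin k) (h : ∃ j : Fin k, M + (i : ℕ) = M + j) : h.choose = i :=
    Fin.ext (Nat.add_left_cancel h.choose_spec).symm
  ext γ
  simp only [Set.mem_ofPred_eq, Condition.satisfying, hmap]
  constructor
  · rintro ⟨⟨hd, hγ⟩, hm⟩
    obtain ⟨h₁, h₂⟩ := (hsat hm).1 hγ
    rw [if_pos h₁, Set.mem_singleton_iff]
    funext v
    by_cases hv : v < M
    · rw [if_pos hv, hm v hv]
    · rw [if_neg hv]
      by_cases h : ∃ i : Fin k, v = M + i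
      · rw [dif_pos h, ← h₂, ← h.choose_spec]
      · rw [dif_neg h]
        exact hd v fun hv' => (hvars.1 hv').elim hv h
  · intro h
    by_cases hc : (0, (List.range M).map δ) ∈ D ∧ ∀ c ∈ L, c.Holds δ
    · rw [if_pos hc, Set.mem_singleton_iff] at h
      subst h
      have hm : ∀ v < M, (if v < M then δ v else if h : ∃ i : Fin k, v = M + i then
        (s h.choose).eval δ else Classical.arbitrary I) = δ v := fun v hv => if_pos hv
      refine ⟨⟨fun v hv => ?_, (hsat hm).2 ⟨hc, fun i => ?_⟩⟩, hm⟩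
      · rw [hvars, not_or] at hv
        exact (if_neg hv.1).trans (dif_neg hv.2)
      · rw [if_neg (by omega), dif_pos ⟨i, rfl⟩, hchoose]
    · rw [if_neg hc] at h
      exact h.elim

open scoped Classical in
theorem bag_identityQuery {M : ℕ} {L : List (Comparison I)} {B : List (Fin k → Term I)}
    (hL : ComparisonsBounded M L) (hB : ∀ s ∈ B, ∀ i, ∀ v ∈ (s i).vars, v < M)
    (D : Database I) (δ : ℕ → I) :
    (identityQuery M L B).bag D ((List.range M).map δ) =
      if (0, (List.range M).map δ) ∈ D ∧ ∀ c ∈ L, c.Holds δ then instBag δ B else 0 := by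
  simp only [Query.bag, identityQuery, List.map_map]
  rw [List.map_congr_left (g := fun s => if (0, (List.range M).map δ) ∈ D ∧ ∀ c ∈ L, c.Holds δ
    then {fun i => (s i).eval δ} else 0)]
  · by_cases hc : (0, (List.range M).map δ) ∈ D ∧ ∀ c ∈ L, c.Holds δ
    · simp only [if_pos hc, sum_map_singleton_coe, instBag, Multiset.map_coe]
    · simp [if_neg hc]
  · intro s hs
    rw [Function.comp_apply, satisfying_tupleCondition hL (hB s hs)]
    by_cases hc : (0, (List.range M).map δ) ∈ D ∧ ∀ c ∈ L, c.Holds δ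
    · simp only [if_pos hc, finsum_mem_singleton]
      congr 1
      funext i
      have h : ∃ j : Fin k, M + (i : ℕ) = M + j := ⟨i, rfl⟩
      rw [if_neg (by omega), dif_pos h,
        show h.choose = i from Fin.ext (Nat.add_left_cancel h.choose_spec).symm]
    · simp only [if_neg hc, finsum_mem_empty]

/-- For one direction, each `δ` satisfying `L` is tested on the database with the single atom
listing its values below `M`. The carrier has at most `M` elements; `M + 1` keeps the bound positive
when `M = 0`. -/
theorem nEquivalent_identityQuery {V : Type*} {α : Multiset (Fin k → I) → V} {M : ℕ}
    {L : List (Comparison I)} {B B' : List (Fin k → Term I)} (hL : ComparisonsBounded M L)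
    (hB : ∀ s ∈ B, ∀ i, ∀ v ∈ (s i).vars, v < M) (hB' : ∀ s ∈ B', ∀ i, ∀ v ∈ (s i).vars, v < M) :
    NEquivalent α (M + 1) (identityQuery M L B) (identityQuery M L B') ↔
      ∀ δ : ℕ → I, (∀ c ∈ L, c.Holds δ) → BagAgree α (instBag δ B) (instBag δ B') := by
  have hwf := identityQuery_wellFormed hL hB
  have hwf' := identityQuery_wellFormed hL hB'
  rw [nEquivalent_iff hwf hwf']
  constructor
  · intro h δ hδ
    have hcard : (Database.carrier {(0, (List.range M).map δ)}).card ≤ M + 1 := by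
      have := ((List.range M).map δ).toFinset_card_le
      simp only [Database.carrier, Finset.singleton_biUnion, List.length_map,
        List.length_range] at this ⊢
      omega
    have := h _ hcard ((List.range M).map δ)
    rwa [bag_identityQuery hL hB, bag_identityQuery hL hB',
      if_pos ⟨Finset.mem_singleton_self _, hδ⟩, if_pos ⟨Finset.mem_singleton_self _, hδ⟩] at this
  · intro h D _ d
    by_cases hd : ∃ δ : ℕ → I, (List.range M).map δ = d
    · obtain ⟨δ, rfl⟩ := hd
      rw [bag_identityQuery hL hB, bag_identityQuery hL hB']
      split_ifs with hc
      · exact h δ hc.2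
      · simp [BagAgree]
    -- A group that is not the image of `List.range M` occurs in neither answer.
    · push Not at hd
      rw [(hwf.bag_eq_zero_iff D d).2 fun A _ γ _ => hd γ,
        (hwf'.bag_eq_zero_iff D d).2 fun A _ γ _ => hd γ]
      simp [BagAgree]

end IdentityQuery

/-! ### Decidability of bounded equivalence implies order-decidability. -/

section Reduction

variable {I : Type*} {k : ℕ}

/-- A strict upper bound for the variables of `L`, `B` and `B'`. -/
def identityBound (L : List (Comparison I)) (B B' : List (Fin k → Term I)) : ℕ :=
  strictBound (L.flatMap (fun c => c.lhs.vars ++ c.rhs.vars) ++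
    (B ++ B').flatMap fun s => (List.ofFn s).flatMap Term.vars)

theorem comparisonsBounded_identityBound (L : List (Comparison I))
    (B B' : List (Fin k → Term I)) : ComparisonsBounded (identityBound L B B') L := fun c hc =>
  ⟨fun _ hv => lt_strictBound (List.mem_append_left _
    (List.mem_flatMap.2 ⟨c, hc, List.mem_append_left _ hv⟩)),
  fun _ hv => lt_strictBound (List.mem_append_left _
    (List.mem_flatMap.2 ⟨c, hc, List.mem_append_right _ hv⟩))⟩

theorem lt_identityBound {L : List (Comparison I)} {B B' : List (Fin k → Term I)}
    {s : Fin k → Term I} (hs : s ∈ B ++ B') (i : Fin k) {v : ℕ} (hv : v ∈ (s i).vars) :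
    v < identityBound L B B' :=
  lt_strictBound (List.mem_append_right _ (List.mem_flatMap.2
    ⟨s, hs, List.mem_flatMap.2 ⟨s i, List.mem_ofFn.2 ⟨i, rfl⟩, hv⟩⟩))

/-- The negation of an ordering predicate. -/
def CmpOp.neg : CmpOp → CmpOp
  | .lt => .ge
  | .le => .gt
  | .eq => .ne
  | .ne => .eq
  | .ge => .lt
  | .gt => .le

theorem CmpOp.holds_neg [LinearOrder I] (o : CmpOp) (a b : I) :
    o.neg.Holds a b ↔ ¬ o.Holds a b := by
  cases o <;> simp [CmpOp.neg, CmpOp.Holds]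

instance : Finite CmpOp := Finite.of_equiv _ CmpOp.equiv.symm

theorem entails_iff [LinearOrder I] {L : List (Comparison I)} {c : Comparison I} :
    Entails L c ↔ ¬ ∃ δ : ℕ → I, ∀ e ∈ L ++ [⟨c.lhs, c.op.neg, c.rhs⟩], e.Holds δ := by
  simp only [Entails, List.mem_append, List.mem_singleton, or_imp, forall_and, forall_eq,
    not_exists, not_and]
  simp only [Comparison.Holds, CmpOp.holds_neg, not_not]

theorem bagAgree_iff_of_ne_zero {V : Type*} {α : Multiset (Fin k → I) → V}
    {B B' : Multiset (Fin k → I)} (hB : B ≠ 0) (hB' : B' ≠ 0) :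
    BagAgree α B B' ↔ α B = α B' := by
  simp [BagAgree, hB, hB']

/-- Here the value of `α` itself reveals whether the bag is empty. -/
theorem bagAgree_iff_of_forall_ne {V : Type*} {α : Multiset (Fin k → I) → V}
    (hα : ∀ B, B ≠ 0 → α B ≠ α 0)
    (B B' : Multiset (Fin k → I)) :
    BagAgree α B B' ↔ α B = α B' := by
  by_cases hB : B = 0 <;> by_cases hB' : B' = 0
  · simp [BagAgree, hB, hB']
  · simp [BagAgree, hB, hB', (hα B' hB').symm]
  · simp [BagAgree, hB, hB', hα B hB]
  · exact bagAgree_iff_of_ne_zero hB hB'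

variable [Primcodable I]

theorem primrec_identityQuery {σ : Type*} [Primcodable σ] {M : σ → ℕ}
    {L : σ → List (Comparison I)} {B : σ → List (Fin k → Term I)} (hM : Primrec M)
    (hL : Primrec L) (hB : Primrec B) :
    Primrec fun a => identityQuery (M a) (L a) (B a) := by
  refine Query.primrec_mk (Primrec.list_range.comp hM)
    (primrec_tuple fun i => Primrec.nat_add.comp hM (Primrec.const _))
    (Primrec.list_map hB (Condition.primrec_mk ?_ (Primrec.const []) ?_))
  · exact Primrec.list_cons.comp (Atom.primrec_mk (Primrec.const 0)
      (Primrec.list_map (Primrec.list_range.comp (hM.comp Primrec.fst))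
        (Term.primrec_var.comp₂ Primrec₂.right))) (Primrec.const [])
  · refine Primrec.list_append.comp (hL.comp Primrec.fst) (Primrec.list_ofFn fun i => ?_)
    exact Comparison.primrec_mk
      (Term.primrec_var.comp (Primrec.nat_add.comp (hM.comp Primrec.fst) (Primrec.const _)))
      (Primrec.const _) (primrec_apply Primrec.snd i)

theorem primrec_identityBound {σ : Type*} [Primcodable σ]
    {L : σ → List (Comparison I)} {B B' : σ → List (Fin k → Term I)}
    (hL : Primrec L) (hB : Primrec B) (hB' : Primrec B') :
    Primrec fun a => identityBound (L a) (B a) (B' a) := by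
  refine primrec_strictBound.comp (Primrec.list_append.comp (Primrec.list_flatMap hL ?_)
    (Primrec.list_flatMap (Primrec.list_append.comp hB hB') (Primrec.list_flatMap
      (Primrec.list_ofFn fun i => primrec_apply Primrec.snd i)
      (Term.primrec_vars.comp₂ Primrec₂.right))))
  exact Primrec.list_append.comp
    (Term.primrec_vars.comp (Comparison.primrec_lhs.comp Primrec.snd))
    (Term.primrec_vars.comp (Comparison.primrec_rhs.comp Primrec.snd))

variable [LinearOrder I] [Nonempty I] {V : Type*} {α : Multiset (Fin k → I) → V}

/-- `L` may be any conjunction, not only a complete ordering; the use for entailment depends on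
this. -/
theorem computablePred_bagAgree (h : BoundedEquivalenceDecidable α) :
    ComputablePred fun x : List (Comparison I) × List (Fin k → Term I) × List (Fin k → Term I) =>
      ∀ δ : ℕ → I, (∀ c ∈ x.1, c.Holds δ) → BagAgree α (instBag δ x.2.1) (instBag δ x.2.2) := by
  let X := List (Comparison I) × List (Fin k → Term I) × List (Fin k → Term I)
  have hL : Primrec fun x : X => x.1 := Primrec.fst
  have hB : Primrec fun x : X => x.2.1 := Primrec.fst.comp Primrec.snd
  have hB' : Primrec fun x : X => x.2.2 := Primrec.snd.comp Primrec.snd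
  have hM := primrec_identityBound hL hB hB'
  refine (ComputablePred.comp h ((Primrec.succ.comp hM).pair
    ((primrec_identityQuery hM hL hB).pair (primrec_identityQuery hM hL hB'))).to_comp).of_eq
    fun x => ?_
  have bL := comparisonsBounded_identityBound x.1 x.2.1 x.2.2
  have bB : ∀ s ∈ x.2.1, ∀ i, ∀ v ∈ (s i).vars, v < identityBound x.1 x.2.1 x.2.2 :=
    fun s hs i v => lt_identityBound (List.mem_append_left _ hs) i
  have bB' : ∀ s ∈ x.2.2, ∀ i, ∀ v ∈ (s i).vars, v < identityBound x.1 x.2.1 x.2.2 :=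
    fun s hs i v => lt_identityBound (List.mem_append_right _ hs) i
  rw [← nEquivalent_identityQuery bL bB bB']
  exact ⟨fun h => h.2.2.2, fun h => ⟨Nat.succ_pos _, identityQuery_wellFormed bL bB,
    identityQuery_wellFormed bL bB', h⟩⟩

/-- Entailment of `c` is unsatisfiability of `L` together with the negation of `c`. A one-element
bag and the empty bag never agree, so they agree under all satisfying assignments only if there are
none. -/
theorem computablePred_entails (h : BoundedEquivalenceDecidable α) :
    ComputablePred fun x : List (Comparison I) × Comparison I => Entails x.1 x.2 := by
  let s₀ : Fin k → Term I := fun _ => .const (Classical.arbitrary I)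
  have hneg : Primrec fun x : List (Comparison I) × Comparison I =>
      x.1 ++ [⟨x.2.lhs, x.2.op.neg, x.2.rhs⟩] :=
    Primrec.list_append.comp Primrec.fst (Primrec.list_cons.comp
      (Comparison.primrec_mk (Comparison.primrec_lhs.comp Primrec.snd)
        ((Primrec.dom_finite CmpOp.neg).comp (Comparison.primrec_op.comp Primrec.snd))
        (Comparison.primrec_rhs.comp Primrec.snd)) (Primrec.const []))
  refine (ComputablePred.comp (computablePred_bagAgree h)
    (hneg.pair (Primrec.const ([s₀], []))).to_comp).of_eq fun x => ?_
  rw [entails_iff, not_exists]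
  refine forall_congr' fun δ => imp_congr_right fun _ => ?_
  simp [BagAgree, instBag]

theorem computablePred_isOrdered (h : BoundedEquivalenceDecidable α) :
    ComputablePred fun e : Identity I k => e.IsOrdered := by
  have hT : Primrec fun e : Identity I k => e.T := Identity.primrec_T
  have hmem {B : Identity I k → List (Fin k → Term I)} (hB : Primrec B) :
      PrimrecPred fun e => ∀ s ∈ B e, ∀ i, s i ∈ e.T := by
    have : PrimrecPred fun e => ∀ s ∈ B e, ∀ t ∈ List.ofFn s, t ∈ e.T :=
      PrimrecPred.forall_mem hB (PrimrecPred.forall_mem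
        (Primrec.list_ofFn fun i => primrec_apply Primrec.snd i)
        (PrimrecPred.mem_list Primrec.snd (hT.comp (Primrec.fst.comp Primrec.fst))))
    exact this.of_eq fun e => by simp [List.mem_ofFn]
  have hcmp : PrimrecPred fun e : Identity I k => ∀ c ∈ e.L, c.lhs ∈ e.T ∧ c.rhs ∈ e.T :=
    PrimrecPred.forall_mem Identity.primrec_L (PrimrecPred.and
      (PrimrecPred.mem_list (Comparison.primrec_lhs.comp Primrec.snd) (hT.comp Primrec.fst))
      (PrimrecPred.mem_list (Comparison.primrec_rhs.comp Primrec.snd) (hT.comp Primrec.fst)))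
  have hent (o : CmpOp) : ComputablePred fun p : (Identity I k × Term I) × Term I =>
      Entails p.1.1.L ⟨p.1.2, o, p.2⟩ :=
    ComputablePred.comp (computablePred_entails h)
      ((Identity.primrec_L.comp (Primrec.fst.comp Primrec.fst)).pair
        (Comparison.primrec_mk (Primrec.snd.comp Primrec.fst) (Primrec.const o)
          Primrec.snd)).to_comp
  refine ComputablePred.and (hcmp.computablePred.and ?_)
    ((hmem Identity.primrec_B).and (hmem Identity.primrec_B')).computablePred
  refine ComputablePred.forall_mem hT.to_comp
    (ComputablePred.forall_mem (hT.comp Primrec.fst).to_comp ?_)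
  exact ((hent .lt).and ((hent .gt).not.and (hent .eq).not)).or
    (((hent .lt).not.and ((hent .gt).and (hent .eq).not)).or
      ((hent .lt).not.and ((hent .gt).not.and (hent .eq))))

/-- Bounded equivalence never evaluates `α` on the empty bag. If `α` takes the value `α 0` on some
nonempty bag, then that bag is substituted for the empty one. -/
theorem computablePred_valid (h : BoundedEquivalenceDecidable α) :
    ComputablePred fun e : Identity I k => e.Valid α := by
  have hBA := computablePred_bagAgree h
  -- The case distinction is not effective, but it depends only on the fixed `α`, and an algorithm
  -- exists in either case.
  by_cases hα : ∀ B, B ≠ 0 → α B ≠ α 0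
  · refine (hBA.comp (Identity.primrec_L.pair
      (Identity.primrec_B.pair Identity.primrec_B')).to_comp).of_eq fun e => ?_
    simp only [bagAgree_iff_of_forall_ne hα, Identity.Valid]
  · push Not at hα
    obtain ⟨β, hβ, hαβ⟩ := hα
    classical
    -- The substitute bag is written with constants, so it instantiates to `β` under every `δ`.
    let G : List (Fin k → Term I) := β.toList.map fun s i => .const (s i)
    have hG (δ : ℕ → I) : instBag δ G = β := by
      simp only [instBag, G, Multiset.map_coe, List.map_map]
      refine Eq.trans ?_ (Multiset.coe_toList β)
      congr 1
      exact (List.map_congr_left (g := id) fun s _ => rfl).trans (List.map_id _)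
    let fill : List (Fin k → Term I) → List (Fin k → Term I) := fun B => if B = [] then G else B
    have hfill : Primrec fill :=
      Primrec.ite (Primrec.eq.comp Primrec.id (Primrec.const [])) (Primrec.const G) Primrec.id
    have hne (δ : ℕ → I) (B : List (Fin k → Term I)) : instBag δ (fill B) ≠ 0 := by
      by_cases hB : B = []
      · simp only [fill, if_pos hB, hG]
        exact hβ
      · simp only [fill, if_neg hB]
        exact mt instBag_eq_zero.1 hB
    have hval (δ : ℕ → I) (B : List (Fin k → Term I)) :
        α (instBag δ (fill B)) = α (instBag δ B) := by
      by_cases hB : B = []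
      · simp only [fill, if_pos hB, hG, hαβ]
        rw [instBag_eq_zero.2 hB]
      · simp only [fill, if_neg hB]
    refine (hBA.comp (Identity.primrec_L.pair ((hfill.comp Identity.primrec_B).pair
      (hfill.comp Identity.primrec_B'))).to_comp).of_eq fun e => ?_
    simp only [bagAgree_iff_of_ne_zero (hne _ _) (hne _ _), hval, Identity.Valid]

theorem orderDecidable_of_boundedEquivalenceDecidable (h : BoundedEquivalenceDecidable α) :
    OrderDecidable α :=
  (computablePred_isOrdered h).and (computablePred_valid h)

end Reduction

end AggQuery

theorem theoremt {I : Type*} [Primcodable I] [LinearOrder I] [Nonempty I] {k : ℕ} {V : Type*}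
    (α : Multiset (Fin k → I) → V) :
    AggQuery.BoundedEquivalenceDecidable α ↔ AggQuery.OrderDecidable α :=
  ⟨AggQuery.orderDecidable_of_boundedEquivalenceDecidable,
    AggQuery.boundedEquivalenceDecidable_of_orderDecidable⟩
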